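/- Let $\mathcal K$ be a decorated braid projection of an oriented knot: a braid diagram drawn vertically, with strands oriented upwards, closed up by strands running around to the right, whose distinguished edge is the strand that closes up the leftmost strand position. Let $n$ be the number of crossings and $c(\mathcal K)$ the set of crossings. Cut the distinguished edge into two segments, so that the diagram has $2n+1$ edges $e_0,\dots,e_{2n}$, with $e_0$ the second segment of the distinguished edge along its orientation, and set $\mathcal R=\mathbb Z[U_0,\dots,U_{2n}]$, with $U_i$ the variable of $e_i$. At a crossing $p$ let $a,b$ be the top left and top right (outgoing) edges and $c,d$ the bottom left and bottom right (incoming) edges, and put $L(p)=U_a+U_b-U_c-U_d$. Let $L_{\mathcal K}$ be the ideal generated by all $L(p)$, $p\in c(\mathcal K)$, and $\mathcal R'=\mathcal R/L_{\mathcal K}$. A complete resolution $S$ of $\mathcal K$ is obtained by singularizing (replacing by a four-valent vertex) the crossings in a subset $c(S)\subseteq c(\mathcal K)$ and smoothing the others compatibly with the orientation; a smoothed crossing becomes two two-valent vertices, a left one between $c$ and $a$ and a right one between $d$ and $b$. The cut point of the distinguished edge is not a vertex. Let $\mathscr B_{\mathrm{KR}}(S)=\bigotimes_{p\in c(\mathcal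 K)}\mathcal Q_S(p)$, where $\mathcal Q_S(p)$ is the two-step complex $\mathcal R'\to\mathcal R'$ in homological degrees $1$ and $0$ whose differential is multiplication by $U_a-U_c$ if $p$ is smoothed in $S$, and by $(U_a-U_c)(U_a-U_d)$ if $p$ is singularized. Let $L_S\subset\mathcal R$ be the ideal generated by the $L(p)$ with $p\in c(S)$. For a vertex $p$ of $S$ put $Q(p)=U_aU_b-U_cU_d$ if $p$ is four-valent, and $Q(p)=U_e-U_f$ if $p$ is two-valent with outgoing edge $e$ and incoming edge $f$. On each connected component of $S$ that does not contain $e_0$ choose a two-valent vertex that is the right-hand vertex of a smoothed crossing (such a vertex always exists), and call these vertices special. Let $Q_S\subset\mathcal R$ be the ideal generated by the $Q(p)$ for all vertices $p$ of $S$ that are not special. Let $V_S$ be the free $\mathcal R$-module on the connected components of $S$ that do not contain $e_0$. **Theorem.** For every complete resolution $S$ of $\mathcal K$ and every choice of special vertices, $$H_*(\mathscr B_{\mathrm{KR}}(S))\;\cong\;\operatorname{Tor}^{\mathcal R}_*(\mathcal R/L_S,\mathcal R/Q_S)\otimes_{\mathcal R}\wedge^*V_S$$ as graded $\mathcal R$-modules;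 that is, for every $i\ge 0$ there is an isomorphism of $\mathcal R$-modules $$H_i(\mathscr B_{\mathrm{KR}}(S))\cong\bigoplus_{j+l=i}\operatorname{Tor}^{\mathcal R}_j(\mathcal R/L_S,\mathcal R/Q_S)\otimes_{\mathcal R}\wedge^{l}V_S .$$ -/

import Mathlib

open CategoryTheory MonoidalCategory
open scoped TensorProduct DirectSum

noncomputable section

namespace BraidKR

/-- The two strands at a crossing: the left one and the right one. -/
inductive Side where
  | left : Side
  | right : Side
  deriving DecidableEq

/-- A decorated braid projection of an oriented knot. The braid is drawn vertically, oriented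
upwards, on `k + 1` strand positions (columns) numbered `0, …, k` from left to right; it has `n`
crossings, numbered `0, …, n - 1` from bottom to top, the crossing `t` involving the columns
`pos t` and `pos t + 1` and having sign `sign t`. The diagram is the braid closure, i.e. the top of
each column is joined with its bottom by a strand running around to the right. The distinguished
edge is the one that closes up the leftmost column; it is subdivided in two. The field `isKnot`
says that the closure is a knot: the permutation underlying the braid is a single cycle. -/
structure DecoratedBraid where
  k : ℕ
  n : ℕ
  pos : Fin n → Fin k
  sign : Fin n → ℤˣ
  isKnot : ∀ i j : Fin (k + 1),
    (List.ofFn fun t : Fin n => Equiv.swap (pos t).castSucc (pos t).succ).prod.SameCycle i j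

namespace DecoratedBraid

variable (K : DecoratedBraid)

/-- The edges `e_0, …, e_{2n}` of the diagram, the distinguished edge being cut in two segments.
Every edge but one starts at a crossing: `some (t, s)` is the edge that leaves the crossing `t` at
its top left or top right corner. The remaining edge `none` is `e_0`, the second segment of the
distinguished edge, which starts at the cut and runs to the bottom of column `0`. -/
abbrev Edge : Type := Option (Fin K.n × Side)

/-- The edge `e_0`. -/
def baseEdge : K.Edge := none

/-- The column of the left, resp. right, strand at the crossing `t`. -/
def column (t : Fin K.n) : Side → Fin (K.k + 1)
  | .left => (K.pos t).castSucc
  | .right => (K.pos t).succ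

/-- The edge leaving the crossing `t` at its top left, resp. top right, corner. -/
def outEdge (t : Fin K.n) (s : Side) : K.Edge := some (t, s)

/-- The edge that leaves the last one of the crossings `0, …, h - 1` on column `i`, on that
column; `none` if there is no such crossing. -/
def lastEdge : ℕ → Fin (K.k + 1) → Option (Fin K.n × Side)
  | 0, _ => none
  | h + 1, i =>
    if hh : h < K.n then
      if K.column ⟨h, hh⟩ .left = i then some (⟨h, hh⟩, .left)
      else if K.column ⟨h, hh⟩ .right = i then some (⟨h, hh⟩, .right)
      else lastEdge h i
    else lastEdge h i

/-- The edge entering the crossing `t` at its bottom left, resp. bottom right, corner: it comes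
from the previous crossing on the same column. If there is none, one has reached the bottom of the
column. On column `0` the edge is then `e_0`; on any other column it comes around from the top of
the column, hence from the last crossing there. -/
def inEdge (t : Fin K.n) (s : Side) : K.Edge :=
  (K.lastEdge t (K.column t s)).or
    (if K.column t s = 0 then K.baseEdge else K.lastEdge K.n (K.column t s))

/-- The polynomial ring over `ℤ` with one variable `U e` for each edge `e`. -/
abbrev Ring : Type := MvPolynomial K.Edge ℤ

/-- The variable of an edge. -/
def U (e : K.Edge) : K.Ring := MvPolynomial.X e

/-- `L(p) = U_a + U_b - U_c - U_d`. Here and below `a`, `b` are the top left and top right edges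
at the crossing, and `c`, `d` the bottom left and bottom right ones. -/
def L (t : Fin K.n) : K.Ring :=
  K.U (K.outEdge t .left) + K.U (K.outEdge t .right)
    - K.U (K.inEdge t .left) - K.U (K.inEdge t .right)

/-- A complete resolution, given by the set `c(S)` of the crossings that are singularized; the
other crossings are smoothed. -/
abbrev CompleteResolution : Type := Finset (Fin K.n)

/-- The ideal generated by the `L(p)` for all crossings `p` of the diagram. -/
def idealLK : Ideal K.Ring := Ideal.span (Set.range K.L)

/-- The edge ring `R' = R / L_K`. -/
abbrev EdgeRing : Type := K.Ring ⧸ K.idealLK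

variable {K} (S : K.CompleteResolution)

/-- The ideal `L_S`, generated by the `L(p)` for the singularized crossings `p`. -/
def idealL : Ideal K.Ring := Ideal.span {x | ∃ t ∈ S, K.L t = x}

/-- The vertices of the graph of `S`: a four-valent one for each singularized crossing, and two
two-valent ones, the left one and the right one, for each smoothed crossing. -/
inductive Vertex where
  | four (t : Fin K.n) (h : t ∈ S) : Vertex
  | two (t : Fin K.n) (h : t ∉ S) (s : Side) : Vertex

variable {S}

/-- The set of edges that meet at a vertex. -/
def Vertex.edges : Vertex S → Set K.Edge
  | .four t _ => {K.outEdge t .left, K.outEdge t .right, K.inEdge t .left, K.inEdge t .right}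
  | .two t _ s => {K.outEdge t s, K.inEdge t s}

/-- `Q(p) = U_a U_b - U_c U_d` at a four-valent vertex, `Q(p) = U_e - U_f` at a two-valent one. -/
def Vertex.Q : Vertex S → K.Ring
  | .four t _ => K.U (K.outEdge t .left) * K.U (K.outEdge t .right)
      - K.U (K.inEdge t .left) * K.U (K.inEdge t .right)
  | .two t _ s => K.U (K.outEdge t s) - K.U (K.inEdge t s)

variable (S)

/-- The connected components of `S`, as classes of edges under the equivalence relation generated
by meeting at a vertex. -/
def Component : Type := Quot fun e f : K.Edge => ∃ v : Vertex S, e ∈ v.edges ∧ f ∈ v.edges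

/-- The component of an edge. -/
def componentOf (e : K.Edge) : Component S := Quot.mk _ e

/-- The connected components of `S` that do not contain `e_0`. -/
abbrev OtherComponent : Type := {C : Component S // C ≠ componentOf S K.baseEdge}

/-- A choice of special vertices: on each component without `e_0`, a two-valent vertex that is the
right hand side of a smoothed crossing. -/
structure SpecialVertices where
  crossing : OtherComponent S → Fin K.n
  smoothed : ∀ C, crossing C ∉ S
  mem : ∀ C, componentOf S (K.outEdge (crossing C) .right) = C.1

variable {S}

/-- The special vertex on a component. -/
def SpecialVertices.vertex (σ : SpecialVertices S) (C : OtherComponent S) : Vertex S :=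
  .two (σ.crossing C) (σ.smoothed C) .right

/-- The ideal `Q_S`, generated by the `Q(p)` for all vertices `p` that are not special. -/
def idealQ (σ : SpecialVertices S) : Ideal K.Ring :=
  Ideal.span {x | ∃ v : Vertex S, (∀ C, v ≠ σ.vertex C) ∧ v.Q = x}

/-! Special vertices exist for every complete resolution. -/

theorem componentOf_inEdge (t : Fin K.n) (s : Side) :
    componentOf S (K.inEdge t s) = componentOf S (K.outEdge t s) := by
  by_cases h : t ∈ S
  · refine Quot.sound ⟨.four t h, ?_, ?_⟩ <;> cases s <;> simp [Vertex.edges]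
  · refine Quot.sound ⟨.two t h s, ?_, ?_⟩ <;> simp [Vertex.edges]

theorem column_inj (t : Fin K.n) {s s' : Side} (h : K.column t s = K.column t s') : s = s' := by
  cases s <;> cases s' <;> simp_all [column, Fin.ext_iff]

theorem lastEdge_succ_self (t : Fin K.n) (s : Side) :
    K.lastEdge (t + 1) (K.column t s) = some (t, s) := by
  have hne : K.column t .left ≠ K.column t .right := fun h => by cases column_inj t h
  cases s <;> simp [lastEdge, t.2, hne]

theorem lastEdge_succ_of_ne (h : ℕ) (i : Fin (K.k + 1))
    (hi : ∀ (t : Fin K.n) (s : Side), (t : ℕ) = h → K.column t s ≠ i) :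
    K.lastEdge (h + 1) i = K.lastEdge h i := by
  rw [lastEdge]
  split_ifs with h1 h2 h3
  · exact absurd h2 (hi _ _ rfl)
  · exact absurd h3 (hi _ _ rfl)
  · rfl
  · rfl

theorem componentOf_lastEdge (h : ℕ) (t : Fin K.n) (s : Side) (ht : (t : ℕ) < h) :
    ∃ e, K.lastEdge h (K.column t s) = some e ∧
      componentOf S (some e) = componentOf S (K.outEdge t s) := by
  induction h with
  | zero => omega
  | succ h ih =>
    by_cases hx : ∃ (t' : Fin K.n) (s' : Side), (t' : ℕ) = h ∧ K.column t' s' = K.column t s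
    · obtain ⟨t', s', rfl, hc⟩ := hx
      refine ⟨(t', s'), by rw [← hc, lastEdge_succ_self], ?_⟩
      rcases (Nat.lt_succ_iff.1 ht).lt_or_eq with hlt | heq
      · obtain ⟨e, he, hce⟩ := ih hlt
        rw [← hce]
        have := componentOf_inEdge (S := S) t' s'
        rw [inEdge, hc, he] at this
        exact this.symm
      · have : t = t' := Fin.ext heq
        subst this
        rw [column_inj t hc]
        rfl
    · push Not at hx
      have hne : (t : ℕ) ≠ h := fun e => hx t s e rfl
      rw [lastEdge_succ_of_ne h _ hx]
      exact ih (by omega)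

/-- Edges leaving a crossing on the same column lie in the same component. -/
theorem componentOf_eq_of_column (t t' : Fin K.n) (s s' : Side)
    (h : K.column t s = K.column t' s') :
    componentOf S (K.outEdge t s) = componentOf S (K.outEdge t' s') := by
  obtain ⟨e, he, hc⟩ := componentOf_lastEdge (S := S) K.n t s t.2
  obtain ⟨e', he', hc'⟩ := componentOf_lastEdge (S := S) K.n t' s' t'.2
  rw [h, he'] at he
  cases he
  rw [← hc, ← hc']

/-- An edge leaving a crossing on column `0` lies in the component of `e_0`. -/
theorem componentOf_column_zero (t : Fin K.n) (s : Side) (h : K.column t s = 0) :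
    componentOf S (K.outEdge t s) = componentOf S K.baseEdge := by
  classical
  have hex : ∃ m : ℕ, ∃ (t : Fin K.n) (s : Side), (t : ℕ) = m ∧ K.column t s = 0 :=
    ⟨t, t, s, rfl, h⟩
  obtain ⟨t', s', ht', hs'⟩ := Nat.find_spec hex
  have hnone : ∀ m ≤ Nat.find hex, K.lastEdge m (0 : Fin (K.k + 1)) = none := by
    intro m
    induction m with
    | zero => intro _; rfl
    | succ m ih =>
      intro hm
      rw [lastEdge_succ_of_ne, ih (by omega)]
      intro u r hu hr
      exact Nat.find_min hex (m := m) (by omega) ⟨u, r, hu, hr⟩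
  rw [componentOf_eq_of_column t t' s s' (h.trans hs'.symm), ← componentOf_inEdge, inEdge, hs',
    hnone _ ht'.le, if_pos rfl, Option.none_or]

/-- In a knot diagram any two neighbouring columns are joined by a crossing. -/
theorem exists_pos (j : Fin K.k) : ∃ t, K.pos t = j := by
  by_contra! hne
  have key : ∀ l : List (Equiv.Perm (Fin (K.k + 1))),
      (∀ g ∈ l, ∀ x, x ≤ j.castSucc ↔ g x ≤ j.castSucc) →
        ∀ x, x ≤ j.castSucc ↔ l.prod x ≤ j.castSucc := by
    intro l
    induction l with
    | nil => simp
    | cons g l ih =>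
      intro hl x
      rw [List.prod_cons, Equiv.Perm.mul_apply, ← hl g (by simp)]
      exact ih (fun g' hg' => hl g' (by simp [hg'])) x
  have hinv := key (List.ofFn fun t : Fin K.n => Equiv.swap (K.pos t).castSucc (K.pos t).succ) (by
    intro g hg x
    obtain ⟨t, rfl⟩ := (List.mem_ofFn' _ _).1 hg
    have hj := hne t
    rw [Ne, Fin.ext_iff] at hj
    simp only [Equiv.swap_apply_def]
    split_ifs with h1 h2
    · subst h1
      simp only [Fin.le_def, Fin.val_succ, Fin.val_castSucc]
      omega
    · subst h2
      simp only [Fin.le_def, Fin.val_succ, Fin.val_castSucc]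
      omega
    · rfl)
  obtain ⟨z, hz⟩ := K.isKnot j.castSucc j.succ
  have hpow : ∀ z : ℤ, ∀ f : Equiv.Perm (Fin (K.k + 1)),
      (∀ x, x ≤ j.castSucc ↔ f x ≤ j.castSucc) → ∀ x, x ≤ j.castSucc ↔ (f ^ z) x ≤ j.castSucc := by
    intro z f hf
    induction z with
    | zero => simp
    | succ i ih => intro x; rw [zpow_add_one, Equiv.Perm.mul_apply, ← ih, ← hf]
    | pred i ih =>
      intro x; rw [zpow_sub_one, Equiv.Perm.mul_apply, ← ih, hf (f⁻¹ x)]; simp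
  have := (hpow z _ hinv j.castSucc).1 le_rfl
  rw [hz] at this
  simp [Fin.le_def] at this

variable (S) in
theorem SpecialVertices.nonempty : Nonempty (SpecialVertices S) := by
  classical
  have main : ∀ C : OtherComponent S,
      ∃ t, t ∉ S ∧ componentOf S (K.outEdge t .right) = C.1 := by
    rintro ⟨C, hC⟩
    have hex : ∃ m : ℕ, ∃ (t : Fin K.n) (s : Side),
        (K.column t s : ℕ) = m ∧ componentOf S (K.outEdge t s) = C := by
      induction C using Quot.ind with
      | mk e =>
        match e with
        | none => exact absurd rfl hC
        | some (t, s) => exact ⟨_, t, s, rfl, rfl⟩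
    obtain ⟨t, s, hm, htC⟩ := Nat.find_spec hex
    have h0 : K.column t s ≠ 0 := fun h => hC (htC ▸ componentOf_column_zero t s h)
    obtain ⟨j, hj⟩ := Fin.exists_succ_eq.2 h0
    obtain ⟨u, hu⟩ := exists_pos j
    have hcol : K.column u .right = K.column t s := by rw [← hj, column, hu]
    have huC := (componentOf_eq_of_column (S := S) u t .right s hcol).trans htC
    refine ⟨u, fun hS => ?_, huC⟩
    refine Nat.find_min hex (m := K.column u .left) ?_ ⟨u, .left, rfl, ?_⟩
    · rw [← hm, ← hj]; simp [column, hu]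
    · rw [← huC]
      exact Quot.sound ⟨.four u hS, by simp [Vertex.edges], by simp [Vertex.edges]⟩
  choose f hf using main
  exact ⟨⟨f, fun C => (hf C).1, fun C => (hf C).2⟩⟩

variable (S)

/-- The free module `V_S` on the components that do not contain `e_0`. -/
abbrev V : Type := OtherComponent S →₀ K.Ring

open scoped Classical in
/-- The element by which the differential of the two-step complex at the crossing `t` multiplies:
`U_a - U_c` for a smoothing, `(U_a - U_c)(U_a - U_d)` for a singularization. -/
def stepElement (t : Fin K.n) : K.Ring :=
  if t ∈ S then
    (K.U (K.outEdge t .left) - K.U (K.inEdge t .left)) *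
      (K.U (K.outEdge t .left) - K.U (K.inEdge t .right))
  else K.U (K.outEdge t .left) - K.U (K.inEdge t .left)

/-- The two-step complex `R' ⟶ R'` at the crossing `t`, in degrees `1` and `0`, as a complex of
modules over the polynomial ring `R`. -/
def twoStep (t : Fin K.n) : ChainComplex (ModuleCat.{0} K.Ring) ℕ :=
  HomologicalComplex.double (i₀ := 1) (i₁ := 0)
    (ModuleCat.ofHom (LinearMap.lsmul K.Ring K.EdgeRing (stepElement S t)))
    (show (ComplexShape.down ℕ).Rel 1 0 from rfl)

/-- The Koszul complex `B_KR(S)`: the tensor product of the two-step complexes of all crossings.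
The tensor product is taken over `R`; as `R'` is a quotient ring of `R`, it is the same one as over
`R'` (and for an empty set of crossings `R' = R`). -/
def complexKR : ChainComplex (ModuleCat.{0} K.Ring) ℕ :=
  (List.ofFn (twoStep S)).foldr (fun A B => A ⊗ B) (𝟙_ _)

/-- `Tor_i(R / I, R / J)` over `R`. -/
abbrev torQuotients {R : Type} [CommRing R] (I J : Ideal R) (i : ℕ) : ModuleCat.{0} R :=
  ((Tor (ModuleCat.{0} R) i).obj (ModuleCat.of R (R ⧸ I))).obj (ModuleCat.of R (R ⧸ J))

end DecoratedBraid

end BraidKR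

end

/-! Write K(x_1, …, x_m; C) for the iterated cone of multiplication by the x_i on a complex C
(`kos`). Up to quasi-isomorphism, the order of the x_i is irrelevant (`QE.kos_perm`), an x_i may be
changed by an element acting null-homotopically on the coefficients (`QE.cone_congr`), and a regular
sequence with coefficients in a quotient ring may be traded for the further quotient
(`exists_quasiIso_kos_sgl`). The theorem follows by rewriting one Koszul complex.

The complex of S is K(step elements; R/L_K) (`QE.tensorDbl`). The L(p) are regular in every order
(`nzdMod_L`), so R/L_K may be replaced by K(L(p), p smoothed; R/L_S). At a singularized crossing,
(U_a - U_c)(U_a - U_d) equals -Q(p) modulo L(p); at a smoothed one, the step element is Q of the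
left vertex, and L(p) minus it is Q of the right vertex. The complex is therefore K(Q(v), all
vertices v; R/L_S) (`QE.flatMap_relationsAt`).

On a component without e_0 the differences "outgoing minus incoming variable" sum to zero, which
puts Q of its special vertex into L_S + Q_S (`special_Q_mem`). This ideal acts null-homotopically on
K(Q(v), v ordinary; R/L_S), so the special entries can be replaced by zeros (`complexKR_equiv`).
Each zero adds a shifted copy of the homology, which produces the exterior algebra
(`homology_kos_replicate_zero`). What remains computes Tor, because the ordinary Q(v) form a regular
sequence and their Koszul complex over R resolves R/Q_S (`torQuotients_equiv`).

Both regularity statements rest on integer weights on the edges with divergence 1 at one ordinary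
vertex and 0 at the other ordinary ones (`hasWeight`): a unit of flow is routed to e_0 or to a
special vertex, where nothing is required. If all crossings are singularized, translating each U_e
by its weight times a new variable moves just one L(p) (`nzdMod_of_translation`). For the Q(v), the
weights make the other relations homogeneous and the outgoing monomial at v heavier than the
incoming one, so Q(v) is regular as soon as its outgoing monomial is (`nzdMod_of_weight`).
Exchanging relations for outgoing monomials one at a time (`nzdMod_of_exchange`) leaves monomials in
disjoint sets of variables (`nzdMod_top`). -/

noncomputable section

namespace KoszulCone

variable {R : Type} [CommRing R]

/-! Homology of chain complexes of modules in terms of elements. -/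

/-- The differential `C_{n+1} → C_n` as a linear map. -/
abbrev dl (C : ChainComplex (ModuleCat.{0} R) ℕ) (n : ℕ) : C.X (n + 1) →ₗ[R] C.X n :=
  (C.d (n + 1) n).hom

/-- The cycles of degree `n`; the truncated subtraction is harmless as `C.d 0 0 = 0`. -/
abbrev Cyc (C : ChainComplex (ModuleCat.{0} R) ℕ) (n : ℕ) : Submodule R (C.X n) :=
  LinearMap.ker (C.d n (n - 1)).hom

theorem mem_cyc_zero (C : ChainComplex (ModuleCat.{0} R) ℕ) (x : C.X 0) : x ∈ Cyc C 0 := by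
  simp

theorem mem_cyc_succ (C : ChainComplex (ModuleCat.{0} R) ℕ) (n : ℕ) (x : C.X (n + 1)) :
    x ∈ Cyc C (n + 1) ↔ dl C n x = 0 := Iff.rfl

theorem next_eq (n : ℕ) : (ComplexShape.down ℕ).next n = n - 1 := by
  cases n with
  | zero => exact ChainComplex.next_nat_zero
  | succ n => exact ChainComplex.next_nat_succ n

/-- A cycle, as an element of `C.cycles n`. -/
def toCycles (C : ChainComplex (ModuleCat.{0} R) ℕ) (n : ℕ) : Cyc C n →ₗ[R] C.cycles n :=
  (C.liftCycles (ModuleCat.ofHom (Cyc C n).subtype) (n - 1) (next_eq n)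
    (by ext x; exact x.2)).hom

theorem iCycles_toCycles (C : ChainComplex (ModuleCat.{0} R) ℕ) (n : ℕ) (z : Cyc C n) :
    C.iCycles n (toCycles C n z) = z :=
  congr($(C.liftCycles_i (ModuleCat.ofHom (Cyc C n).subtype) (n - 1) (next_eq n)
      (by ext x; exact x.2)) z)

theorem iCycles_injective (C : ChainComplex (ModuleCat.{0} R) ℕ) (n : ℕ) :
    Function.Injective (C.iCycles n) :=
  (ModuleCat.mono_iff_injective (C.iCycles n)).1 inferInstance

/-- The class of a cycle in homology. -/
def cls (C : ChainComplex (ModuleCat.{0} R) ℕ) (n : ℕ) : Cyc C n →ₗ[R] C.homology n :=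
  (C.homologyπ n).hom ∘ₗ toCycles C n

theorem cls_surjective (C : ChainComplex (ModuleCat.{0} R) ℕ) (n : ℕ) :
    Function.Surjective (cls C n) := by
  intro y
  obtain ⟨z, rfl⟩ := (ModuleCat.epi_iff_surjective (C.homologyπ n)).1 inferInstance y
  refine ⟨⟨C.iCycles n z, congr($(C.iCycles_d n (n - 1)) z)⟩, ?_⟩
  refine congrArg (C.homologyπ n) (iCycles_injective C n ?_)
  rw [iCycles_toCycles]

theorem cls_eq_zero_iff (C : ChainComplex (ModuleCat.{0} R) ℕ) (n : ℕ) (z : Cyc C n) :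
    cls C n z = 0 ↔ ∃ w, dl C n w = z := by
  have hex : (ShortComplex.mk (C.toCycles (n + 1) n) (C.homologyπ n)
      (C.toCycles_comp_homologyπ _ _)).Exact :=
    ShortComplex.exact_of_g_is_cokernel _ (C.homologyIsCokernel (n + 1) n (by simp))
  rw [ShortComplex.moduleCat_exact_iff] at hex
  have ht : ∀ w, C.iCycles n (C.toCycles (n + 1) n w) = dl C n w := fun w =>
    congr($(C.toCycles_i (n + 1) n) w)
  constructor
  · intro h
    obtain ⟨w, hw⟩ := hex _ h
    exact ⟨w, by rw [← ht, ← iCycles_toCycles]; exact congrArg _ hw⟩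
  · rintro ⟨w, hw⟩
    have : toCycles C n z = C.toCycles (n + 1) n w := by
      apply iCycles_injective
      rw [iCycles_toCycles, ht, hw]
    refine (congrArg (C.homologyπ n) this).trans ?_
    exact congr($(C.toCycles_comp_homologyπ (n + 1) n) w)

variable {C D : ChainComplex (ModuleCat.{0} R) ℕ}

theorem map_dl (f : C ⟶ D) (n : ℕ) (x : C.X (n + 1)) :
    f.f n (dl C n x) = dl D n (f.f (n + 1) x) :=
  congr($((f.comm (n + 1) n).symm) x)

theorem map_mem_cyc (f : C ⟶ D) (n : ℕ) (x : C.X n) (hx : x ∈ Cyc C n) :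
    f.f n x ∈ Cyc D n := by
  have := congr($(f.comm n (n - 1)) x)
  simp only [ModuleCat.hom_comp, LinearMap.comp_apply] at this
  change D.d n (n - 1) _ = 0
  erw [this, (show C.d n (n - 1) x = 0 from hx), map_zero]

theorem homologyMap_cls (f : C ⟶ D) (n : ℕ) (z : Cyc C n) :
    HomologicalComplex.homologyMap f n (cls C n z) =
      cls D n ⟨f.f n z, map_mem_cyc f n z z.2⟩ := by
  refine (congr($(HomologicalComplex.homologyπ_naturality f n) (toCycles C n z))).trans ?_
  refine congrArg (D.homologyπ n) (iCycles_injective D n ?_)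
  refine (congr($(HomologicalComplex.cyclesMap_i f n) _)).trans ?_
  rw [iCycles_toCycles]
  exact congrArg (f.f n) (iCycles_toCycles C n z)

/-- A quasi-isomorphism of complexes of modules, in terms of elements. -/
theorem quasiIso_iff (f : C ⟶ D) : QuasiIso f ↔ ∀ n,
    (∀ z ∈ Cyc C n, (∃ w, dl D n w = f.f n z) → ∃ w, dl C n w = z) ∧
    (∀ y ∈ Cyc D n, ∃ z ∈ Cyc C n, ∃ w, dl D n w = f.f n z - y) := by
  have key : ∀ n, QuasiIsoAt f n ↔
      Function.Bijective (HomologicalComplex.homologyMap f n) := by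
    intro n
    rw [quasiIsoAt_iff_isIso_homologyMap, ← ConcreteCategory.isIso_iff_bijective]
  rw [_root_.quasiIso_iff]
  refine forall_congr' fun n => ?_
  rw [key]
  refine and_congr ⟨fun h z hz hw => ?_, fun h => ?_⟩ ⟨fun h y hy => ?_, fun h y => ?_⟩
  · rw [← cls_eq_zero_iff C n ⟨z, hz⟩]
    apply h
    rw [homologyMap_cls, map_zero, cls_eq_zero_iff]
    exact hw
  · refine (injective_iff_map_eq_zero
      (HomologicalComplex.homologyMap f n).hom).2 fun a ha => ?_
    obtain ⟨z, rfl⟩ := cls_surjective C n a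
    rw [cls_eq_zero_iff]
    refine h z z.2 ?_
    have := (homologyMap_cls f n z).symm.trans ha
    rwa [cls_eq_zero_iff] at this
  · obtain ⟨a, ha⟩ := h (cls D n ⟨y, hy⟩)
    obtain ⟨z, rfl⟩ := cls_surjective C n a
    rw [homologyMap_cls, ← sub_eq_zero, ← map_sub, cls_eq_zero_iff] at ha
    exact ⟨z, z.2, ha⟩
  · obtain ⟨y, rfl⟩ := cls_surjective D n y
    obtain ⟨z, hz, hw⟩ := h y y.2
    refine ⟨cls C n ⟨z, hz⟩, ?_⟩
    rw [homologyMap_cls, ← sub_eq_zero, ← map_sub, cls_eq_zero_iff]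
    exact hw

end KoszulCone

/-! ### Cones of multiplication by a ring element. -/

namespace KoszulCone

variable {R : Type} [CommRing R]

/-- A chain map given by linear maps. -/
def mkMap {C D : ChainComplex (ModuleCat.{0} R) ℕ} (f : ∀ n, C.X n →ₗ[R] D.X n)
    (h : ∀ n x, f n (dl C n x) = dl D n (f (n + 1) x)) : C ⟶ D where
  f n := ModuleCat.ofHom (f n)
  comm' i j hij := by
    obtain rfl : j + 1 = i := hij
    ext x
    exact (h j x).symm

/-- An isomorphism of chain complexes given by linear equivalences. -/
def mkIso {C D : ChainComplex (ModuleCat.{0} R) ℕ} (f : ∀ n, C.X n ≃ₗ[R] D.X n)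
    (h : ∀ n x, f n (dl C n x) = dl D n (f (n + 1) x)) : C ≅ D :=
  HomologicalComplex.Hom.isoOfComponents (fun n => (f n).toModuleIso) (by
    intro i j hij
    obtain rfl : j + 1 = i := hij
    ext x
    exact (h j x).symm)

/-- The terms of the cone of multiplication by a ring element. -/
def coneX (C : ChainComplex (ModuleCat.{0} R) ℕ) : ℕ → ModuleCat.{0} R
  | 0 => C.X 0
  | n + 1 => ModuleCat.of R (C.X (n + 1) × C.X n)

/-- The differential of the cone of multiplication by a ring element. -/
def coneD (x : R) (C : ChainComplex (ModuleCat.{0} R) ℕ) :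
    ∀ n, coneX C (n + 1) →ₗ[R] coneX C n
  | 0 => (dl C 0).coprod (x • LinearMap.id)
  | n + 1 => ((dl C (n + 1)).coprod (x • LinearMap.id)).prod (-(dl C n ∘ₗ LinearMap.snd R _ _))

theorem dl_dl (C : ChainComplex (ModuleCat.{0} R) ℕ) (n : ℕ) (y) :
    dl C n (dl C (n + 1) y) = 0 :=
  congr($(C.d_comp_d (n + 2) (n + 1) n) y)

/-- The Koszul cone of `x` on `C`: the total complex of multiplication by `x` on `C`. -/
def cone (x : R) (C : ChainComplex (ModuleCat.{0} R) ℕ) : ChainComplex (ModuleCat.{0} R) ℕ :=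
  ChainComplex.of (coneX C) (fun n => ModuleCat.ofHom (coneD x C n)) (by
    intro n
    ext ⟨a, b⟩
    cases n with
    | zero =>
      change dl C 0 (dl C 1 a + x • b) + x • -(dl C 0 b) = 0
      simp [dl_dl]
    | succ n =>
      refine Prod.ext ?_ ?_
      · change dl C (n + 1) (dl C (n + 2) a + x • b) + x • -(dl C (n + 1) b) = 0
        simp [dl_dl]
      · change -(dl C n (-(dl C (n + 1) b))) = 0
        simp [dl_dl])

section

variable (x : R) (C : ChainComplex (ModuleCat.{0} R) ℕ)

theorem dl_cone (n : ℕ) : dl (cone x C) n = coneD x C n := by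
  let d : ∀ n, coneX C (n + 1) ⟶ coneX C n := fun n => ModuleCat.ofHom (coneD x C n)
  exact congrArg ModuleCat.Hom.hom (ChainComplex.of_d (coneX C) d n)

theorem dl_cone_zero (a : C.X 1) (b : C.X 0) :
    dl (cone x C) 0 (show C.X 1 × C.X 0 from (a, b)) = (dl C 0 a + x • b : C.X 0) := by
  rw [dl_cone]; rfl

theorem dl_cone_succ (n : ℕ) (a : C.X (n + 2)) (b : C.X (n + 1)) :
    dl (cone x C) (n + 1) (show C.X (n + 2) × C.X (n + 1) from (a, b)) =
      (show C.X (n + 1) × C.X n from (dl C (n + 1) a + x • b, -dl C n b)) := by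
  rw [dl_cone]; rfl

end

theorem smul_mem_cyc {C : ChainComplex (ModuleCat.{0} R) ℕ} {n : ℕ} {x : R} {z : C.X n}
    (hz : z ∈ Cyc C n) : x • z ∈ Cyc C n := Submodule.smul_mem _ _ hz

variable {C D : ChainComplex (ModuleCat.{0} R) ℕ}

/-- Functoriality of the cone. -/
def coneMap (x : R) (f : C ⟶ D) : cone x C ⟶ cone x D :=
  mkMap (fun n => match n with
    | 0 => (f.f 0).hom
    | n + 1 => (f.f (n + 1)).hom.prodMap (f.f n).hom) (by
    rintro (_ | n) ⟨a, b⟩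
    · erw [dl_cone_zero, dl_cone_zero]
      change f.f 0 (dl C 0 a + x • b) = dl D 0 (f.f 1 a) + x • f.f 0 b
      rw [map_add, map_smul, map_dl]
    · erw [dl_cone_succ, dl_cone_succ]
      refine Prod.ext ?_ ?_
      · change f.f (n + 1) (dl C (n + 1) a + x • b) =
          dl D (n + 1) (f.f (n + 2) a) + x • f.f (n + 1) b
        rw [map_add, map_smul, map_dl]
      · change f.f n (-dl C n b) = -dl D n (f.f (n + 1) b)
        rw [map_neg, map_dl])

theorem coneMap_f_succ (x : R) (f : C ⟶ D) (n : ℕ) (a : C.X (n + 1)) (b : C.X n) :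
    (coneMap x f).f (n + 1) (show C.X (n + 1) × C.X n from (a, b)) =
      (show D.X (n + 1) × D.X n from (f.f (n + 1) a, f.f n b)) := rfl

/-- A pair is a cycle of the cone iff the second entry is a cycle and the differential of the first
one cancels `x` times the second one. -/
theorem mem_cyc_cone (x : R) (n : ℕ) (a : C.X (n + 1)) (b : C.X n) :
    (show C.X (n + 1) × C.X n from (a, b)) ∈ Cyc (cone x C) (n + 1) ↔
      b ∈ Cyc C n ∧ dl C n a + x • b = 0 := by
  refine (mem_cyc_succ (cone x C) n _).trans ?_
  cases n with
  | zero =>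
    erw [dl_cone_zero]
    exact ⟨fun h => ⟨mem_cyc_zero _ _, h⟩, fun h => h.2⟩
  | succ n =>
    erw [dl_cone_succ, Prod.ext_iff]
    refine ⟨fun h => ⟨?_, h.1⟩, fun h => ⟨h.2, ?_⟩⟩
    · exact neg_eq_zero.1 h.2
    · exact neg_eq_zero.2 h.1

/-- This is the five lemma for the long exact sequence of the cone, done as an element chase: the
second entry is settled first, and the first entry is then corrected by multiples of `x`. -/
theorem quasiIso_coneMap (x : R) (f : C ⟶ D) (hf : QuasiIso f) : QuasiIso (coneMap x f) := by
  rw [quasiIso_iff] at hf ⊢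
  rintro (_ | n)
  · refine ⟨fun (z : C.X 0) _ => ?_, fun (y : D.X 0) _ => ?_⟩
    · rintro ⟨⟨a, b⟩, hab⟩
      erw [dl_cone_zero] at hab
      change dl D 0 a + x • b = f.f 0 z at hab
      obtain ⟨c, -, w, hw⟩ := (hf 0).2 b (mem_cyc_zero _ _)
      obtain ⟨v, hv⟩ := (hf 0).1 (z - x • c) (mem_cyc_zero _ _) ⟨a - x • w, by
        rw [map_sub, map_smul, hw, map_sub, ← hab, map_smul, smul_sub]; abel⟩
      refine ⟨(show C.X 1 × C.X 0 from (v, c)), ?_⟩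
      erw [dl_cone_zero, hv]
      change z - x • c + x • c = z
      abel
    · obtain ⟨z, -, w, hw⟩ := (hf 0).2 y (mem_cyc_zero _ _)
      refine ⟨z, mem_cyc_zero _ _, (show D.X 1 × D.X 0 from (w, 0)), ?_⟩
      erw [dl_cone_zero, hw]
      change _ + x • (0 : D.X 0) = _
      rw [smul_zero, add_zero]
      rfl
  · refine ⟨?_, ?_⟩
    · rintro ⟨a, b⟩ hz ⟨⟨p, q⟩, hpq⟩
      erw [mem_cyc_cone] at hz
      erw [dl_cone_succ, coneMap_f_succ] at hpq
      obtain ⟨h1, h2⟩ := Prod.ext_iff.1 hpq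
      change dl D (n + 1) p + x • q = f.f (n + 1) a at h1
      change -dl D n q = f.f n b at h2
      -- With a primitive `c` of `b`, the element `q + f c` is a cycle. A cycle `e` of `C`
      -- representing its class makes `a + x • c - x • e` a cycle whose image is a boundary.
      obtain ⟨c, hc⟩ := (hf n).1 b hz.1 ⟨-q, by rw [map_neg, h2]⟩
      have hq : q + f.f (n + 1) c ∈ Cyc D (n + 1) := by
        rw [mem_cyc_succ, map_add]
        erw [← map_dl, hc, ← h2]
        abel
      obtain ⟨e, he, w, hw⟩ := (hf (n + 1)).2 _ hq
      obtain ⟨v, hv⟩ := (hf (n + 1)).1 (a + x • c - x • e) (by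
          rw [mem_cyc_succ] at he ⊢
          rw [map_sub, map_add, map_smul, map_smul, he, hc, hz.2]; simp) ⟨p - x • w, by
        rw [map_sub, map_smul, hw, map_sub, map_add, map_smul, map_smul, ← h1, smul_sub, smul_add]
        abel⟩
      refine ⟨(show C.X (n + 2) × C.X (n + 1) from (v, e - c)), ?_⟩
      erw [dl_cone_succ]
      refine Prod.ext ?_ ?_
      · change dl C (n + 1) v + x • (e - c) = a
        rw [hv, smul_sub]; abel
      · change -dl C n (e - c) = b
        rw [mem_cyc_succ] at he
        rw [map_sub, he, hc]; abel
    · rintro ⟨p, q⟩ hy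
      erw [mem_cyc_cone] at hy
      obtain ⟨c, hc, w, hw⟩ := (hf n).2 q hy.1
      -- The class of `x • c` dies in `C` because `x • q` is the boundary of `-p`.
      obtain ⟨e, he⟩ := (hf n).1 (x • c) (smul_mem_cyc hc) ⟨x • w - p, by
        rw [map_sub, map_smul, hw, map_smul, smul_sub, eq_neg_of_add_eq_zero_left hy.2]; abel⟩
      obtain ⟨g, hg, u, hu⟩ := (hf (n + 1)).2 (p + f.f (n + 1) e - x • w) (by
        rw [mem_cyc_succ, map_sub, map_add]
        erw [← map_dl]
        rw [he, map_smul, map_smul, hw, eq_neg_of_add_eq_zero_left hy.2, smul_sub]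
        abel)
      refine ⟨(show C.X (n + 1) × C.X n from (g - e, c)), ?_,
        (show D.X (n + 2) × D.X (n + 1) from (u, -w)), ?_⟩
      · erw [mem_cyc_cone]
        rw [mem_cyc_succ] at hg
        refine ⟨hc, ?_⟩
        rw [map_sub, hg, he]; abel
      · erw [dl_cone_succ, coneMap_f_succ]
        refine Prod.ext ?_ ?_
        · change dl D (n + 1) u + x • (-w) = f.f (n + 1) (g - e) - p
          rw [hu, map_sub, smul_neg]; abel
        · change -dl D n (-w) = f.f n c - q
          rw [map_neg, neg_neg, hw]

end KoszulCone

/-! ### Zigzags of quasi-isomorphisms, null-homotopic elements and the calculus of cones. -/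

namespace KoszulCone

variable {R : Type} [CommRing R]

/-- The equivalence relation generated by quasi-isomorphisms. -/
def QE (C D : ChainComplex (ModuleCat.{0} R) ℕ) : Prop :=
  Relation.EqvGen (fun C D => ∃ f : C ⟶ D, QuasiIso f) C D

variable {C D E : ChainComplex (ModuleCat.{0} R) ℕ}

theorem QE.refl (C : ChainComplex (ModuleCat.{0} R) ℕ) : QE C C := Relation.EqvGen.refl _

theorem QE.symm (h : QE C D) : QE D C := Relation.EqvGen.symm _ _ h

theorem QE.trans (h : QE C D) (h' : QE D E) : QE C E := Relation.EqvGen.trans _ _ _ h h'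

theorem QE.of_quasiIso (f : C ⟶ D) (hf : QuasiIso f) : QE C D := .rel _ _ ⟨f, hf⟩

theorem QE.of_iso (e : C ≅ D) : QE C D := .of_quasiIso e.hom inferInstance

theorem QE.cone (x : R) (h : QE C D) : QE (cone x C) (KoszulCone.cone x D) := by
  induction h with
  | rel C D h => exact .of_quasiIso (coneMap x h.choose) (quasiIso_coneMap _ _ h.choose_spec)
  | refl => exact .refl _
  | symm _ _ _ ih => exact ih.symm
  | trans _ _ _ _ _ ih ih' => exact ih.trans ih'

theorem QE.homology (h : QE C D) (n : ℕ) : Nonempty (C.homology n ≃ₗ[R] D.homology n) := by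
  induction h with
  | rel C D h =>
    obtain ⟨f, hf⟩ := h
    exact ⟨(asIso (HomologicalComplex.homologyMap f n)).toLinearEquiv⟩
  | refl => exact ⟨.refl _ _⟩
  | symm _ _ _ ih => exact ⟨ih.some.symm⟩
  | trans _ _ _ _ _ ih ih' => exact ⟨ih.some.trans ih'.some⟩

/-- Multiplication by `z` on `C` is null-homotopic. -/
def NullHtpy (z : R) (C : ChainComplex (ModuleCat.{0} R) ℕ) : Prop :=
  ∃ h : ∀ n, C.X n →ₗ[R] C.X (n + 1), (∀ c, dl C 0 (h 0 c) = z • c) ∧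
    ∀ n c, dl C (n + 1) (h (n + 1) c) + h n (dl C n c) = z • c

theorem NullHtpy.zero (C : ChainComplex (ModuleCat.{0} R) ℕ) : NullHtpy (0 : R) C :=
  ⟨fun _ => 0, by simp, by simp⟩

theorem NullHtpy.add {y z : R} (hy : NullHtpy y C) (hz : NullHtpy z C) :
    NullHtpy (y + z) C := by
  obtain ⟨h, h0, h1⟩ := hy
  obtain ⟨k, k0, k1⟩ := hz
  refine ⟨fun n => h n + k n, fun c => ?_, fun n c => ?_⟩
  · simp [h0, k0, add_smul]
  · rw [add_smul, ← h1, ← k1]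
    simp only [LinearMap.add_apply, map_add]
    abel

theorem NullHtpy.mul (y : R) {z : R} (hz : NullHtpy z C) : NullHtpy (y * z) C := by
  obtain ⟨k, k0, k1⟩ := hz
  refine ⟨fun n => y • k n, fun c => ?_, fun n c => ?_⟩
  · simp [k0, mul_smul]
  · rw [mul_smul, ← k1]
    simp only [LinearMap.smul_apply, map_smul, smul_add]

/-- The elements that act on `C` by maps homotopic to zero form an ideal. -/
def nullIdeal (C : ChainComplex (ModuleCat.{0} R) ℕ) : Ideal R where
  carrier := {z | NullHtpy z C}
  add_mem' := NullHtpy.add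
  zero_mem' := .zero C
  smul_mem' y _ hz := hz.mul y

/-- The homotopy is multiplication by the Koszul generator: it moves the first entry to the second
slot and kills the second entry. -/
theorem self_mem_nullIdeal_cone (x : R) (C : ChainComplex (ModuleCat.{0} R) ℕ) :
    x ∈ nullIdeal (cone x C) := by
  refine ⟨fun n => match n with
    | 0 => LinearMap.inr R (C.X 1) (C.X 0)
    | n + 1 => LinearMap.inr R (C.X (n + 2)) (C.X (n + 1)) ∘ₗ LinearMap.fst R _ _, ?_, ?_⟩
  · intro c
    refine (dl_cone_zero x C 0 c).trans ?_
    rw [map_zero, zero_add]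
    rfl
  · rintro (_ | n) ⟨a, b⟩
    · erw [dl_cone_zero, dl_cone_succ x C 0 0 a]
      refine Prod.ext ?_ ?_
      · change dl C 1 0 + x • a + 0 = x • a
        simp
      · change -dl C 0 a + (dl C 0 a + x • b) = x • b
        simp
    · erw [dl_cone_succ, dl_cone_succ]
      refine Prod.ext ?_ ?_
      · change dl C (n + 2) 0 + x • a + 0 = x • a
        simp
      · change -dl C (n + 1) a + (dl C (n + 1) a + x • b) = x • b
        simp

/-- A homotopy `h` on `C` extends as `h` on the first copy and `-h` on the second. The sign matches
the differential of the second copy and cancels the cross terms containing `x`. -/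
theorem nullIdeal_le_cone (x : R) (C : ChainComplex (ModuleCat.{0} R) ℕ) :
    nullIdeal C ≤ nullIdeal (cone x C) := by
  rintro z ⟨h, h0, h1⟩
  refine ⟨fun n => match n with
    | 0 => LinearMap.inl R (C.X 1) (C.X 0) ∘ₗ h 0
    | n + 1 => (h (n + 1)).prodMap (-h n), ?_, ?_⟩
  · intro c
    refine (dl_cone_zero x C (h 0 c) 0).trans ?_
    rw [smul_zero, add_zero]
    exact h0 c
  · rintro (_ | n) ⟨a, b⟩
    · erw [dl_cone_zero, dl_cone_succ x C 0 (h 1 a) (-h 0 b)]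
      refine Prod.ext ?_ ?_
      · change dl C 1 (h 1 a) + x • (-h 0 b) + h 0 (dl C 0 a + x • b) = z • a
        rw [← h1, map_add, map_smul, smul_neg]
        abel
      · change -dl C 0 (-h 0 b) + 0 = z • b
        rw [← h0]
        simp
    · erw [dl_cone_succ, dl_cone_succ]
      refine Prod.ext ?_ ?_
      · change dl C (n + 2) (h (n + 2) a) + x • (-h (n + 1) b) +
          h (n + 1) (dl C (n + 1) a + x • b) = z • a
        rw [← h1, map_add, map_smul, smul_neg]
        abel
      · change -dl C (n + 1) (-h (n + 1) b) + -h n (-dl C n b) = z • b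
        rw [← h1]
        simp

/-- The shear of a product along a linear map. -/
def shear {M N : Type} [AddCommGroup M] [AddCommGroup N] [Module R M] [Module R N]
    (h : N →ₗ[R] M) : (M × N) ≃ₗ[R] (M × N) where
  toFun p := (p.1 + h p.2, p.2)
  invFun p := (p.1 - h p.2, p.2)
  map_add' p q := by ext <;> simp; abel
  map_smul' r p := by ext <;> simp
  left_inv p := by simp
  right_inv p := by simp

/-- The cone only depends on the homotopy class of multiplication by `x`. -/
theorem QE.cone_congr {x y : R} (h : x - y ∈ nullIdeal C) :
    QE (KoszulCone.cone x C) (KoszulCone.cone y C) := by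
  obtain ⟨h, h0, h1⟩ := h
  refine .of_iso (mkIso (fun n => match n with
    | 0 => .refl R (C.X 0)
    | n + 1 => shear (h n)) ?_)
  rintro (_ | n) ⟨a, b⟩
  · erw [dl_cone_zero, dl_cone_zero y C (a + h 0 b) b]
    change dl C 0 a + x • b = _
    rw [map_add, h0, sub_smul]
    abel
  · erw [dl_cone_succ, dl_cone_succ y C n (a + h (n + 1) b) b]
    refine Prod.ext ?_ rfl
    change dl C (n + 1) a + x • b + h n (-dl C n b) = dl C (n + 1) (a + h (n + 1) b) + y • b
    rw [map_neg, map_add, eq_sub_of_add_eq (h1 n b), sub_smul]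
    abel

theorem QE.cone_neg (x : R) (C : ChainComplex (ModuleCat.{0} R) ℕ) :
    QE (KoszulCone.cone x C) (KoszulCone.cone (-x) C) := by
  refine .of_iso (mkIso (fun n => match n with
    | 0 => .refl R (C.X 0)
    | n + 1 => (LinearEquiv.refl R (C.X (n + 1))).prodCongr (LinearEquiv.neg R)) ?_)
  rintro (_ | n) ⟨a, b⟩
  · erw [dl_cone_zero, dl_cone_zero (-x) C a (-b)]
    change dl C 0 a + x • b = _
    simp
  · erw [dl_cone_succ, dl_cone_succ (-x) C n a (-b)]
    refine Prod.ext ?_ ?_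
    · change dl C (n + 1) a + x • b = dl C (n + 1) a + (-x) • (-b)
      simp
    · change -(-dl C n b) = -dl C n (-b)
      simp

/-- Interchange of the middle factors of a product of two products, the last entry negated. -/
def swapEquiv (A B N : Type) [AddCommGroup A] [AddCommGroup B] [AddCommGroup N] [Module R A]
    [Module R B] [Module R N] : ((A × B) × (B × N)) ≃ₗ[R] ((A × B) × (B × N)) where
  toFun p := ((p.1.1, p.2.1), (p.1.2, -p.2.2))
  invFun p := ((p.1.1, p.2.1), (p.1.2, -p.2.2))
  map_add' p q := by simp [add_comm]
  map_smul' r p := by simp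
  left_inv p := by simp
  right_inv p := by simp

/-- Interchanging two Koszul generators of degree one costs a sign on the summand that carries both
of them. This summand is absent in degree 1, which therefore has its own case. -/
theorem QE.cone_comm (x y : R) (C : ChainComplex (ModuleCat.{0} R) ℕ) :
    QE (KoszulCone.cone x (KoszulCone.cone y C)) (KoszulCone.cone y (KoszulCone.cone x C)) := by
  refine .of_iso (mkIso (fun n => match n with
    | 0 => .refl R (C.X 0)
    | 1 => ((LinearEquiv.refl R ((C.X 1 × C.X 0) × C.X 0)).trans
        (LinearEquiv.prodAssoc R (C.X 1) (C.X 0) (C.X 0))).trans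
        (((LinearEquiv.refl R (C.X 1)).prodCongr (LinearEquiv.prodComm R (C.X 0) (C.X 0))).trans
        (LinearEquiv.prodAssoc R (C.X 1) (C.X 0) (C.X 0)).symm)
    | n + 2 => swapEquiv (C.X (n + 2)) (C.X (n + 1)) (C.X n)) ?_)
  rintro (_ | _ | n)
  · rintro ⟨⟨a, b⟩, (c : C.X 0)⟩
    erw [dl_cone_zero, dl_cone_zero]
    erw [dl_cone_zero y (KoszulCone.cone x C) (show C.X 1 × C.X 0 from (a, c)) b]
    erw [dl_cone_zero]
    change dl C 0 a + y • b + x • c = dl C 0 a + x • c + y • b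
    abel
  · rintro ⟨⟨a, b⟩, ⟨c, d⟩⟩
    erw [dl_cone_succ, dl_cone_succ, dl_cone_zero]
    erw [dl_cone_succ y (KoszulCone.cone x C) 0 (show C.X 2 × C.X 1 from (a, c))
      (show C.X 1 × C.X 0 from (b, -d)), dl_cone_succ, dl_cone_zero]
    refine Prod.ext (Prod.ext ?_ ?_) ?_
    · change dl C 1 a + y • b + x • c = dl C 1 a + x • c + y • b
      abel
    · change -(dl C 0 c + y • d) = -dl C 0 c + y • -d
      rw [smul_neg]; abel
    · change -dl C 0 b + x • d = -(dl C 0 b + x • -d)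
      rw [smul_neg]; abel
  · rintro ⟨⟨a, b⟩, ⟨c, d⟩⟩
    erw [dl_cone_succ, dl_cone_succ, dl_cone_succ]
    erw [dl_cone_succ y (KoszulCone.cone x C) (n + 1) (show C.X (n + 3) × C.X (n + 2) from (a, c))
      (show C.X (n + 2) × C.X (n + 1) from (b, -d)), dl_cone_succ, dl_cone_succ]
    refine Prod.ext (Prod.ext ?_ ?_) (Prod.ext ?_ ?_)
    · change dl C (n + 2) a + y • b + x • c = dl C (n + 2) a + x • c + y • b
      abel
    · change -(dl C (n + 1) c + y • d) = -dl C (n + 1) c + y • -d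
      rw [smul_neg]; abel
    · change -dl C (n + 1) b + x • d = -(dl C (n + 1) b + x • -d)
      rw [smul_neg]; abel
    · change -(-(-dl C n d)) = -(-dl C n (-d))
      simp

end KoszulCone

/-! ### Koszul complexes of lists of ring elements. -/

namespace KoszulCone

variable {R : Type} [CommRing R] {C D : ChainComplex (ModuleCat.{0} R) ℕ}

/-- The Koszul complex of a list of ring elements with coefficients in a complex. -/
def kos : List R → ChainComplex (ModuleCat.{0} R) ℕ → ChainComplex (ModuleCat.{0} R) ℕ
  | [], C => C
  | x :: l, C => kos l (cone x C)

theorem kos_append (l l' : List R) (C : ChainComplex (ModuleCat.{0} R) ℕ) :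
    kos (l ++ l') C = kos l' (kos l C) := by
  induction l generalizing C with
  | nil => rfl
  | cons x l ih => exact ih _

theorem QE.kos (l : List R) (h : QE C D) : QE (kos l C) (KoszulCone.kos l D) := by
  induction l generalizing C D with
  | nil => exact h
  | cons x l ih => exact ih (h.cone x)

/-- Functoriality of the Koszul complex. -/
theorem exists_quasiIso_kos (l : List R) (f : C ⟶ D) (hf : QuasiIso f) :
    ∃ g : kos l C ⟶ kos l D, QuasiIso g := by
  induction l generalizing C D with
  | nil => exact ⟨f, hf⟩
  | cons x l ih => exact ih _ (quasiIso_coneMap x f hf)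

theorem QE.kos_perm {l l' : List R} (h : l.Perm l') (C : ChainComplex (ModuleCat.{0} R) ℕ) :
    QE (KoszulCone.kos l C) (KoszulCone.kos l' C) := by
  induction h generalizing C with
  | nil => exact .refl _
  | cons x _ ih => exact ih _
  | swap x y l => exact (QE.cone_comm x y C).kos l
  | trans _ _ ih ih' => exact (ih C).trans (ih' C)

theorem nullIdeal_le_kos (l : List R) (C : ChainComplex (ModuleCat.{0} R) ℕ) :
    nullIdeal C ≤ nullIdeal (kos l C) := by
  induction l generalizing C with
  | nil => exact le_rfl
  | cons x l ih => exact (nullIdeal_le_cone x C).trans (ih _)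

/-- Each entry is null-homotopic on its own cone, and the later cones preserve this. -/
theorem span_le_nullIdeal_kos (l : List R) (C : ChainComplex (ModuleCat.{0} R) ℕ) :
    Ideal.span {x | x ∈ l} ≤ nullIdeal (kos l C) := by
  rw [Ideal.span_le]
  induction l generalizing C with
  | nil => simp
  | cons x l ih =>
    intro y hy
    rcases List.mem_cons.1 hy with rfl | hy
    · exact nullIdeal_le_kos l _ (self_mem_nullIdeal_cone y C)
    · exact ih _ hy

/-- Null-homotopies survive further cones, so the entries can be replaced by zero one after the
other. -/
theorem QE.kos_null (l : List R) (C : ChainComplex (ModuleCat.{0} R) ℕ)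
    (h : ∀ x ∈ l, x ∈ nullIdeal C) :
    QE (KoszulCone.kos l C) (KoszulCone.kos (List.replicate l.length 0) C) := by
  induction l generalizing C with
  | nil => exact .refl _
  | cons x l ih =>
    have h1 : QE (KoszulCone.cone x C) (KoszulCone.cone 0 C) :=
      .cone_congr (by simpa using h x (by simp))
    refine (h1.kos l).trans (ih _ fun y hy => nullIdeal_le_cone _ _ (h y (by simp [hy])))

/-! Koszul complexes of regular sequences on quotient rings. -/

/-- A module as a complex in degree `0`. -/
abbrev sgl (M : ModuleCat.{0} R) : ChainComplex (ModuleCat.{0} R) ℕ :=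
  (ChainComplex.single₀ (ModuleCat.{0} R)).obj M

instance subsingleton_sgl (M : ModuleCat.{0} R) (n : ℕ) : Subsingleton ((sgl M).X (n + 1)) :=
  ModuleCat.subsingleton_of_isZero (HomologicalComplex.isZero_single_obj_X _ _ _ _ (by simp))

theorem le_nullIdeal_sgl (I : Ideal R) : I ≤ nullIdeal (sgl (ModuleCat.of R (R ⧸ I))) := by
  intro z hz
  refine ⟨fun n => 0, fun (c : R ⧸ I) => ?_, fun n c => Subsingleton.elim _ _⟩
  obtain ⟨c, rfl⟩ := Ideal.Quotient.mk_surjective c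
  refine (map_zero _).trans (Eq.symm ?_)
  exact Ideal.Quotient.eq_zero_iff_mem.2 (I.mul_mem_right c hz)

/-- The cone lives in degrees 1 and 0 and is multiplication by `x` on `R ⧸ I`. Regularity removes
the homology in degree 1, and the cokernel is `R ⧸ J`. -/
theorem exists_quasiIso_cone_sgl (x : R) (I J : Ideal R) (hJ : J = I ⊔ Ideal.span {x})
    (hx : ∀ y, x * y ∈ I → y ∈ I) :
    ∃ f : cone x (sgl (ModuleCat.of R (R ⧸ I))) ⟶ sgl (ModuleCat.of R (R ⧸ J)), QuasiIso f := by
  have hIJ : I ≤ J := hJ ▸ le_sup_left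
  have hxJ : x ∈ J := hJ ▸ Ideal.mem_sup_right (Ideal.mem_span_singleton_self x)
  let p : (R ⧸ I) →ₗ[R] (R ⧸ J) := Submodule.factor hIJ
  let C := sgl (ModuleCat.of R (R ⧸ I))
  have hp : ∀ y : (cone x C).X 1, p (dl (cone x C) 0 y) = 0 := by
    rintro ⟨a, (b : R ⧸ I)⟩
    erw [dl_cone_zero]
    obtain ⟨b, rfl⟩ := Ideal.Quotient.mk_surjective b
    obtain rfl : a = 0 := Subsingleton.elim _ _
    rw [map_zero, zero_add]
    exact Ideal.Quotient.eq_zero_iff_mem.2 (J.mul_mem_right b hxJ)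
  refine ⟨(ChainComplex.toSingle₀Equiv _ _).symm ⟨ModuleCat.ofHom p, by ext y; exact hp y⟩, ?_⟩
  set f := (ChainComplex.toSingle₀Equiv (cone x C) (ModuleCat.of R (R ⧸ J))).symm
    ⟨ModuleCat.ofHom p, by ext y; exact hp y⟩ with hfdef
  have hf0 : ∀ z : R ⧸ I, f.f 0 z = p z := fun z =>
    congr($(congrArg Subtype.val ((ChainComplex.toSingle₀Equiv (cone x C)
      (ModuleCat.of R (R ⧸ J))).apply_symm_apply ⟨ModuleCat.ofHom p, by ext y; exact hp y⟩)) z)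
  rw [KoszulCone.quasiIso_iff]
  rintro (_ | _ | n)
  · refine ⟨fun (z : R ⧸ I) _ => ?_, fun (y : R ⧸ J) _ => ?_⟩
    · rintro ⟨w, hw⟩
      obtain rfl : w = 0 := Subsingleton.elim _ _
      rw [map_zero, hf0] at hw
      obtain ⟨z, rfl⟩ := Ideal.Quotient.mk_surjective z
      have hz : z ∈ J := Ideal.Quotient.eq_zero_iff_mem.1 hw.symm
      rw [hJ, Submodule.mem_sup] at hz
      obtain ⟨i, hi, j, hj, rfl⟩ := hz
      obtain ⟨b, rfl⟩ := Ideal.mem_span_singleton'.1 hj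
      refine ⟨(show C.X 1 × (R ⧸ I) from (0, Ideal.Quotient.mk I b)), ?_⟩
      refine (dl_cone_zero x C 0 _).trans ?_
      rw [map_zero, zero_add]
      refine (Ideal.Quotient.eq.2 ?_ : Ideal.Quotient.mk I (x * b) = _)
      rw [mul_comm, sub_add_cancel_right]
      exact I.neg_mem hi
    · obtain ⟨y, rfl⟩ := Ideal.Quotient.mk_surjective y
      refine ⟨Ideal.Quotient.mk I y, mem_cyc_zero _ _, 0, ?_⟩
      rw [map_zero, hf0]
      exact (sub_self _).symm
  · refine ⟨?_, fun y _ => ⟨0, Submodule.zero_mem _, 0, Subsingleton.elim _ _⟩⟩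
    rintro ⟨a, (b : R ⧸ I)⟩ hz -
    obtain rfl : a = 0 := Subsingleton.elim _ _
    have h0 := ((mem_cyc_cone x 0 (0 : C.X 1) b).1 hz).2
    rw [map_zero, zero_add] at h0
    obtain ⟨b, rfl⟩ := Ideal.Quotient.mk_surjective b
    have hb : Ideal.Quotient.mk I b = 0 :=
      Ideal.Quotient.eq_zero_iff_mem.2 (hx b (Ideal.Quotient.eq_zero_iff_mem.1 h0))
    refine ⟨0, ?_⟩
    rw [map_zero]
    exact Prod.ext rfl hb.symm
  · refine ⟨?_, fun y _ => ⟨0, Submodule.zero_mem _, 0, Subsingleton.elim _ _⟩⟩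
    rintro ⟨a, b⟩ hz -
    refine ⟨0, ?_⟩
    rw [map_zero]
    exact Prod.ext (Subsingleton.elim (α := C.X (n + 2)) _ _)
      (Subsingleton.elim (α := C.X (n + 1)) _ _)

/-- The entries of the list form a regular sequence modulo `I`, the quotients being allowed to
vanish. -/
def RegularMod (I : Ideal R) : List R → Prop
  | [] => True
  | x :: l => (∀ y, x * y ∈ I → y ∈ I) ∧ RegularMod (I ⊔ Ideal.span {x}) l

theorem exists_quasiIso_kos_sgl (l : List R) (I J : Ideal R) (hl : RegularMod I l)
    (hJ : J = I ⊔ Ideal.span {x | x ∈ l}) :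
    ∃ f : kos l (sgl (ModuleCat.of R (R ⧸ I))) ⟶ sgl (ModuleCat.of R (R ⧸ J)), QuasiIso f := by
  induction l generalizing I with
  | nil =>
    obtain rfl : J = I := by simpa using hJ
    exact ⟨𝟙 _, inferInstanceAs (QuasiIso (𝟙 _))⟩
  | cons x l ih =>
    obtain ⟨f, hf⟩ := exists_quasiIso_cone_sgl x I _ rfl hl.1
    obtain ⟨g, hg⟩ := exists_quasiIso_kos l f hf
    obtain ⟨h, hh⟩ := ih (I ⊔ Ideal.span {x}) hl.2 (by
      rw [hJ, sup_assoc, ← Ideal.span_union]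
      congr 2
      ext y
      simp)
    exact ⟨g ≫ h, quasiIso_comp g h⟩

theorem projective_kos (l : List R) (hC : ∀ n, Module.Projective R (C.X n)) (n : ℕ) :
    Module.Projective R ((kos l C).X n) := by
  induction l generalizing C with
  | nil => exact hC n
  | cons x l ih =>
    refine ih fun n => ?_
    cases n with
    | zero => exact hC 0
    | succ n =>
      have h1 := hC n
      have h2 := hC (n + 1)
      exact inferInstanceAs (Module.Projective R (C.X (n + 1) × C.X n))

theorem projective_sgl_bot (n : ℕ) :
    Module.Projective R ((sgl (ModuleCat.of R (R ⧸ (⊥ : Ideal R)))).X n) := by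
  cases n with
  | zero =>
    exact Module.Projective.of_equiv (Submodule.quotEquivOfEqBot (⊥ : Ideal R) rfl).symm
  | succ n =>
    have : Module.Free R ((sgl (ModuleCat.of R (R ⧸ (⊥ : Ideal R)))).X (n + 1)) :=
      Module.Free.of_subsingleton _ _
    infer_instance

/-- The Koszul resolution of a quotient by a regular sequence. -/
theorem exists_projectiveResolution (l : List R) (J : Ideal R) (hl : RegularMod ⊥ l)
    (hJ : J = Ideal.span {x | x ∈ l}) :
    ∃ P : ProjectiveResolution (ModuleCat.of R (R ⧸ J)),
      P.complex = kos l (sgl (ModuleCat.of R (R ⧸ (⊥ : Ideal R)))) := by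
  obtain ⟨f, hf⟩ := exists_quasiIso_kos_sgl l ⊥ J hl (by simpa using hJ)
  exact ⟨{ complex := _
           projective := fun n =>
            (IsProjective.iff_projective _).1 (projective_kos l projective_sgl_bot n)
           π := f
           quasiIso := hf }, rfl⟩

/-! Homology of the cone of zero. -/

/-- Two quotients of a module with the same kernel are equivalent. -/
def equivOfKerEq {M A B : Type} [AddCommGroup M] [AddCommGroup A] [AddCommGroup B] [Module R M]
    [Module R A] [Module R B] (f : M →ₗ[R] A) (g : M →ₗ[R] B) (hf : Function.Surjective f)
    (hg : Function.Surjective g) (h : LinearMap.ker f = LinearMap.ker g) : A ≃ₗ[R] B :=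
  (f.quotKerEquivOfSurjective hf).symm.trans
    ((Submodule.quotEquivOfEq _ _ h).trans (g.quotKerEquivOfSurjective hg))

theorem homology_cone_zero (C : ChainComplex (ModuleCat.{0} R) ℕ) :
    Nonempty ((cone 0 C).homology 0 ≃ₗ[R] C.homology 0) := by
  let e : Cyc (cone 0 C) 0 →ₗ[R] Cyc C 0 :=
    { toFun := fun z => ⟨z.1, mem_cyc_zero C z.1⟩
      map_add' := fun _ _ => rfl
      map_smul' := fun _ _ => rfl }
  refine ⟨equivOfKerEq (cls (cone 0 C) 0) (cls C 0 ∘ₗ e) (cls_surjective _ _)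
    ((cls_surjective _ _).comp fun z => ⟨⟨z.1, mem_cyc_zero (cone 0 C) z.1⟩, rfl⟩) ?_⟩
  ext z
  rw [LinearMap.mem_ker, LinearMap.mem_ker, LinearMap.comp_apply, cls_eq_zero_iff,
    cls_eq_zero_iff]
  constructor
  · rintro ⟨⟨a, b⟩, hw⟩
    erw [dl_cone_zero] at hw
    rw [zero_smul, add_zero] at hw
    exact ⟨a, hw⟩
  · rintro ⟨a, hw⟩
    refine ⟨(show C.X 1 × C.X 0 from (a, 0)), ?_⟩
    erw [dl_cone_zero]
    rw [zero_smul, add_zero]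
    exact hw

/-- For `x = 0` the cone is the sum of `C` and its shift; the sign of the shifted differential
affects neither cycles nor boundaries. -/
theorem homology_cone_zero_succ (C : ChainComplex (ModuleCat.{0} R) ℕ) (n : ℕ) :
    Nonempty ((cone 0 C).homology (n + 1) ≃ₗ[R] C.homology (n + 1) × C.homology n) := by
  have hc : ∀ (a : C.X (n + 1)) (b : C.X n),
      (show C.X (n + 1) × C.X n from (a, b)) ∈ Cyc (cone 0 C) (n + 1) ↔
        b ∈ Cyc C n ∧ a ∈ Cyc C (n + 1) := fun a b => by
    refine (mem_cyc_cone 0 n a b).trans ?_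
    rw [zero_smul, add_zero]
    exact Iff.rfl
  let e : Cyc (cone 0 C) (n + 1) →ₗ[R] Cyc C (n + 1) × Cyc C n :=
    { toFun := fun z => (⟨z.1.1, ((hc _ _).1 z.2).2⟩, ⟨z.1.2, ((hc _ _).1 z.2).1⟩)
      map_add' := fun _ _ => rfl
      map_smul' := fun _ _ => rfl }
  have he : Function.Surjective e := by
    rintro ⟨a, b⟩
    exact ⟨⟨(show C.X (n + 1) × C.X n from (a.1, b.1)), (hc _ _).2 ⟨b.2, a.2⟩⟩, rfl⟩
  refine ⟨equivOfKerEq (cls (cone 0 C) (n + 1)) ((cls C (n + 1)).prodMap (cls C n) ∘ₗ e)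
    (cls_surjective _ _)
    ((Prod.map_surjective.2 ⟨cls_surjective _ _, cls_surjective _ _⟩).comp he) ?_⟩
  ext ⟨⟨a, b⟩, hz⟩
  rw [LinearMap.mem_ker, LinearMap.mem_ker, LinearMap.comp_apply, cls_eq_zero_iff,
    LinearMap.prodMap_apply, Prod.mk_eq_zero, cls_eq_zero_iff, cls_eq_zero_iff]
  constructor
  · rintro ⟨⟨p, q⟩, hw⟩
    erw [dl_cone_succ] at hw
    rw [zero_smul, add_zero] at hw
    refine ⟨⟨p, (Prod.ext_iff.1 hw).1⟩, -q, ?_⟩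
    rw [map_neg]
    exact (Prod.ext_iff.1 hw).2
  · rintro ⟨⟨p, hp⟩, q, hq⟩
    refine ⟨(show C.X (n + 2) × C.X (n + 1) from (p, -q)), ?_⟩
    erw [dl_cone_succ]
    rw [zero_smul, add_zero, map_neg, neg_neg]
    exact Prod.ext hp hq

end KoszulCone

/-! ### The exterior algebra factor, and Tor as Koszul homology. -/

namespace KoszulCone

variable {R : Type} [CommRing R]

/-- The homology of a Koszul complex on a list of zeros is a product of copies of the homology
of the coefficients, with binomial multiplicities. -/
theorem homology_kos_replicate_zero (c : ℕ) (C : ChainComplex (ModuleCat.{0} R) ℕ) (i : ℕ) :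
    ∃ (X : Type) (_ : Fintype X) (deg : X → ℕ),
      Nonempty ((kos (List.replicate c (0 : R)) C).homology i ≃ₗ[R] ∀ x, C.homology (deg x)) ∧
      (∀ x, deg x ≤ i) ∧ ∀ j ≤ i, Nat.card {x // deg x = j} = c.choose (i - j) := by
  induction c generalizing i with
  | zero =>
    refine ⟨Unit, inferInstance, fun _ => i, ⟨(LinearEquiv.funUnique Unit R _).symm⟩,
      fun _ => le_rfl, fun j hj => ?_⟩
    rcases hj.eq_or_lt with rfl | hlt
    · simp
    · have : IsEmpty {x : Unit // i = j} := ⟨fun x => hlt.ne' x.2⟩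
      rw [Nat.card_of_isEmpty, Nat.choose_eq_zero_of_lt (by omega)]
  | succ c ih =>
    -- `kos` puts the last entry of the list outermost, so the extra zero is split off at the end.
    rw [List.replicate_succ', kos_append]
    cases i with
    | zero =>
      obtain ⟨X, hX, deg, ⟨e⟩, hle, hcard⟩ := ih 0
      refine ⟨X, hX, deg, ⟨(homology_cone_zero _).some.trans e⟩, hle, fun j hj => ?_⟩
      rw [hcard j hj]
      simp
    | succ i =>
      obtain ⟨X, hX, deg, ⟨e⟩, hle, hcard⟩ := ih (i + 1)
      obtain ⟨Y, hY, deg', ⟨e'⟩, hle', hcard'⟩ := ih i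
      refine ⟨X ⊕ Y, inferInstance, Sum.elim deg deg', ⟨(homology_cone_zero_succ _ i).some.trans
        ((e.prodCongr e').trans (LinearEquiv.sumPiEquivProdPi R X Y
          fun x => C.homology (Sum.elim deg deg' x)).symm)⟩, ?_, fun j hj => ?_⟩
      · rintro (x | y)
        · exact hle x
        · exact (hle' y).trans i.le_succ
      · have h1 : Nat.card {x // Sum.elim deg deg' x = j} =
            Nat.card {x // deg x = j} + Nat.card {y // deg' y = j} := by
          rw [← Nat.card_sum]
          exact Nat.card_congr (Equiv.subtypeSum)
        rw [h1, hcard j hj]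
        rcases hj.eq_or_lt with rfl | hlt
        · have : IsEmpty {y // deg' y = i + 1} :=
            ⟨fun y => by have := hle' y.1; have := y.2; omega⟩
          simp
        -- Pascal's rule: the outer cone contributes the homology in degrees `i + 1` and `i`.
        · rw [hcard' j (by omega), show i + 1 - j = (i - j) + 1 by omega, Nat.choose_succ_succ,
            add_comm]

/-- A tensor product with a free module of finite rank is a power. -/
theorem tensor_free_equiv [Nontrivial R] (M V : Type) [AddCommGroup M] [AddCommGroup V]
    [Module R M] [Module R V] [Module.Free R V] [Module.Finite R V] (X : Type) [Finite X]
    (h : Nat.card X = Module.finrank R V) : Nonempty ((M ⊗[R] V) ≃ₗ[R] (X → M)) := by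
  have := Fintype.ofFinite X
  have : DecidableEq X := Classical.decEq X
  let b := (Module.finBasisOfFinrankEq R V rfl).reindex
    (Fintype.equivOfCardEq (β := X) (by rw [Fintype.card_fin, ← h, Nat.card_eq_fintype_card]))
  exact ⟨(TensorProduct.congr (.refl R M) b.equivFun).trans (TensorProduct.piScalarRight R R M X)⟩

/-- Transport along an equality of indices. -/
def castIndex (H : ℕ → Type) [∀ j, AddCommGroup (H j)] [∀ j, Module R (H j)] {a b : ℕ}
    (h : a = b) : H a ≃ₗ[R] H b := by
  subst h
  exact .refl R _

/-- Only ranks matter: the exterior power of degree `l` is free of rank `(finrank V).choose l`, so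
tensoring with it gives that many copies, and the copies of each `H j` are matched by counting. -/
theorem pi_equiv_directSum [Nontrivial R] (H H' : ℕ → Type) [∀ j, AddCommGroup (H j)]
    [∀ j, Module R (H j)] [∀ j, AddCommGroup (H' j)] [∀ j, Module R (H' j)]
    (e : ∀ j, H j ≃ₗ[R] H' j) (V : Type) [AddCommGroup V] [Module R V] [Module.Free R V]
    [Module.Finite R V] (i : ℕ) (X : Type) [Fintype X] (deg : X → ℕ) (hle : ∀ x, deg x ≤ i)
    (hcard : ∀ j ≤ i, Nat.card {x // deg x = j} = (Module.finrank R V).choose (i - j)) :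
    Nonempty ((∀ x, H (deg x)) ≃ₗ[R]
      ⨁ jl : Finset.HasAntidiagonal.antidiagonal i, H' jl.1.1 ⊗[R] (⋀[R]^(jl.1.2) V)) := by
  classical
  have h1 : ∀ jl : Finset.HasAntidiagonal.antidiagonal i,
      Nonempty (({x // deg x = jl.1.1} → H jl.1.1) ≃ₗ[R] H' jl.1.1 ⊗[R] (⋀[R]^(jl.1.2) V)) := by
    rintro ⟨⟨j, l⟩, hjl⟩
    have hjl : j + l = i := by simpa using hjl
    obtain ⟨f⟩ := tensor_free_equiv (R := R) (H' j) (⋀[R]^l V) {x // deg x = j} (by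
      rw [hcard j (by omega), exteriorPower.finrank_eq, ← hjl, Nat.add_sub_cancel_left])
    exact ⟨(LinearEquiv.piCongrRight fun _ => e j).trans f.symm⟩
  let s : (Σ jl : Finset.HasAntidiagonal.antidiagonal i, {x // deg x = jl.1.1}) ≃ X :=
    { toFun := fun y => y.2.1
      invFun := fun x => ⟨⟨(deg x, i - deg x), by simp [hle x]⟩, ⟨x, rfl⟩⟩
      left_inv := by
        rintro ⟨⟨⟨j, l⟩, hjl⟩, ⟨x, hx⟩⟩
        change deg x = j at hx
        subst hx
        have hjl : deg x + l = i := by simpa using hjl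
        have : l = i - deg x := by omega
        subst this
        rfl
      right_inv := fun x => rfl }
  exact ⟨(LinearEquiv.piCongrLeft R (fun x => H (deg x)) s).symm.trans
    ((LinearEquiv.piCurry R fun jl x => H (deg (s ⟨jl, x⟩))).trans
    ((LinearEquiv.piCongrRight fun jl => (LinearEquiv.piCongrRight fun x =>
      castIndex H x.2).trans (h1 jl).some).trans
    (DirectSum.linearEquivFunOnFintype R _ _).symm))⟩

/-! Tensoring Koszul complexes with a module. -/

/-- Termwise tensor product of a complex with a module. -/
abbrev tens (X : ModuleCat.{0} R) (C : ChainComplex (ModuleCat.{0} R) ℕ) :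
    ChainComplex (ModuleCat.{0} R) ℕ :=
  (((tensoringLeft (ModuleCat.{0} R)).obj X).mapHomologicalComplex (ComplexShape.down ℕ)).obj C

/-- The terms of a termwise tensor product with a cone. -/
def tensConeX (X : ModuleCat.{0} R) (x : R) (C : ChainComplex (ModuleCat.{0} R) ℕ) :
    ∀ n, (tens X (cone x C)).X n ≃ₗ[R] (cone x (tens X C)).X n
  | 0 => .refl R (X ⊗[R] C.X 0)
  | n + 1 => TensorProduct.prodRight R R X (C.X (n + 1)) (C.X n)

theorem tensConeX_dl (X : ModuleCat.{0} R) (x : R) (C : ChainComplex (ModuleCat.{0} R) ℕ) (n : ℕ) :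
    (tensConeX X x C n).toLinearMap ∘ₗ dl (tens X (cone x C)) n =
      dl (cone x (tens X C)) n ∘ₗ (tensConeX X x C (n + 1)).toLinearMap := by
  refine TensorProduct.ext' fun u p => ?_
  rcases n with _ | n
  · obtain ⟨a, b⟩ := p
    refine Eq.trans ?_ (dl_cone_zero x (tens X C) (u ⊗ₜ[R] a) (u ⊗ₜ[R] b)).symm
    refine (congrArg (fun t : C.X 0 => u ⊗ₜ[R] t) (dl_cone_zero x C a b)).trans ?_
    exact (TensorProduct.tmul_add u _ _).trans
      (congrArg (u ⊗ₜ[R] dl C 0 a + ·) (TensorProduct.tmul_smul x u b))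
  · obtain ⟨a, b⟩ := p
    refine Eq.trans ?_ (dl_cone_succ x (tens X C) n (u ⊗ₜ[R] a) (u ⊗ₜ[R] b)).symm
    refine (congrArg (fun t : C.X (n + 1) × C.X n =>
      TensorProduct.prodRight R R X (C.X (n + 1)) (C.X n) (u ⊗ₜ[R] t))
      (dl_cone_succ x C n a b)).trans ?_
    refine (TensorProduct.prodRight_tmul R R _ _ _ _ _).trans (Prod.ext ?_ ?_)
    · exact (TensorProduct.tmul_add u _ _).trans
        (congrArg (u ⊗ₜ[R] dl C (n + 1) a + ·) (TensorProduct.tmul_smul x u b))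
    · exact TensorProduct.tmul_neg u _

/-- Termwise tensor products commute with cones. -/
def tensCone (X : ModuleCat.{0} R) (x : R) (C : ChainComplex (ModuleCat.{0} R) ℕ) :
    tens X (cone x C) ≅ cone x (tens X C) :=
  mkIso (tensConeX X x C) fun n y => LinearMap.congr_fun (tensConeX_dl X x C n) y

theorem QE.tens_kos (X : ModuleCat.{0} R) (l : List R) (C : ChainComplex (ModuleCat.{0} R) ℕ) :
    QE (tens X (KoszulCone.kos l C)) (KoszulCone.kos l (tens X C)) := by
  induction l generalizing C with
  | nil => exact .refl _
  | cons x l ih => exact (ih _).trans ((QE.of_iso (tensCone X x C)).kos l)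

theorem QE.tens_sgl (X : ModuleCat.{0} R) (M N : ModuleCat.{0} R) (e : (X ⊗[R] M) ≃ₗ[R] N) :
    QE (tens X (sgl M)) (sgl N) :=
  .of_iso (((HomologicalComplex.singleMapHomologicalComplex
    ((tensoringLeft (ModuleCat.{0} R)).obj X) (ComplexShape.down ℕ) 0).app M).trans
    ((ChainComplex.single₀ (ModuleCat.{0} R)).mapIso e.toModuleIso))

open BraidKR DecoratedBraid in
/-- `Tor` of two quotients, the second one by a regular sequence, is Koszul homology. -/
theorem torQuotients_equiv (I J : Ideal R) (l : List R) (hl : RegularMod ⊥ l)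
    (hJ : J = Ideal.span {x | x ∈ l}) (j : ℕ) :
    Nonempty (torQuotients I J j ≃ₗ[R] (kos l (sgl (ModuleCat.of R (R ⧸ I)))).homology j) := by
  obtain ⟨P, hP⟩ := exists_projectiveResolution l J hl hJ
  let F := (tensoringLeft (ModuleCat.{0} R)).obj (ModuleCat.of R (R ⧸ I))
  have e := (P.isoLeftDerivedObj F j).toLinearEquiv
  have h : QE ((F.mapHomologicalComplex (ComplexShape.down ℕ)).obj P.complex)
      (kos l (sgl (ModuleCat.of R (R ⧸ I)))) := by
    rw [hP]
    refine (QE.tens_kos _ l _).trans (QE.kos l (.tens_sgl _ _ _ ?_))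
    exact (TensorProduct.congr (.refl R (R ⧸ I)) (Submodule.quotEquivOfEqBot ⊥ rfl)).trans
      (TensorProduct.rid R _)
  exact ⟨e.trans (h.homology j).some⟩

end KoszulCone

/-! ### Tensor products with a two-step complex as cones. -/

namespace KoszulCone

open HomologicalComplex

variable {R : Type} [CommRing R]

/-- The two-step complex `f : A → B` in degrees `1` and `0`. -/
abbrev dbl {A B : ModuleCat.{0} R} (f : A ⟶ B) : ChainComplex (ModuleCat.{0} R) ℕ :=
  double (i₀ := 1) (i₁ := 0) f (show (ComplexShape.down ℕ).Rel 1 0 from rfl)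

section

variable {A B : ModuleCat.{0} R} (f : A ⟶ B) (C : ChainComplex (ModuleCat.{0} R) ℕ)

abbrev dblIso₀ : (dbl f).X 0 ≅ B :=
  doubleXIso₁ f (show (ComplexShape.down ℕ).Rel 1 0 from rfl) one_ne_zero

abbrev dblIso₁ : (dbl f).X 1 ≅ A :=
  doubleXIso₀ f (show (ComplexShape.down ℕ).Rel 1 0 from rfl)

/-- The tensor product of a two-step complex with a complex. -/
abbrev dblTensor : ChainComplex (ModuleCat.{0} R) ℕ := HomologicalComplex.tensorObj (dbl f) C

/-- The inclusion of the summands coming from degree `0` of the two-step complex. -/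
def dblIncl₀ (n : ℕ) : B ⊗ C.X n ⟶ (dblTensor f C).X n :=
  ((dblIso₀ f).inv ▷ C.X n) ≫ ιTensorObj (dbl f) C 0 n n (zero_add n)

/-- The inclusion of the summands coming from degree `1` of the two-step complex. -/
def dblIncl₁ (n : ℕ) : A ⊗ C.X n ⟶ (dblTensor f C).X (n + 1) :=
  ((dblIso₁ f).inv ▷ C.X n) ≫ ιTensorObj (dbl f) C 1 n (n + 1) (add_comm 1 n)

theorem dblIncl₀_d (n : ℕ) :
    dblIncl₀ f C (n + 1) ≫ (dblTensor f C).d (n + 1) n =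
      (B ◁ C.d (n + 1) n) ≫ dblIncl₀ f C n := by
  simp only [dblIncl₀, Category.assoc, mapBifunctor.d_eq, Preadditive.comp_add,
    mapBifunctor.ι_D₁, mapBifunctor.ι_D₂]
  rw [mapBifunctor.d₁_eq_zero _ _ _ _ _ _ _ (by simp),
    mapBifunctor.d₂_eq _ _ _ _ _ (show (ComplexShape.down ℕ).Rel (n + 1) n from rfl) _
      (zero_add n), Limits.comp_zero, zero_add]
  rw [show ComplexShape.ε₂ (ComplexShape.down ℕ) (ComplexShape.down ℕ) (ComplexShape.down ℕ)
    (0, n + 1) = 1 from rfl, one_smul]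
  change (dblIso₀ f).inv ▷ C.X (n + 1) ≫ ((dbl f).X 0 ◁ C.d (n + 1) n) ≫
    ιTensorObj (dbl f) C 0 n n _ = _
  rw [whisker_exchange_assoc]

theorem dblIncl₁_d_zero :
    dblIncl₁ f C 0 ≫ (dblTensor f C).d 1 0 = (f ▷ C.X 0) ≫ dblIncl₀ f C 0 := by
  simp only [dblIncl₀, dblIncl₁, Category.assoc, mapBifunctor.d_eq, Preadditive.comp_add,
    mapBifunctor.ι_D₁, mapBifunctor.ι_D₂]
  rw [mapBifunctor.d₂_eq_zero _ _ _ _ _ _ _ (by simp),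
    mapBifunctor.d₁_eq _ _ _ _ (show (ComplexShape.down ℕ).Rel 1 0 from rfl) _ _
      (zero_add 0), Limits.comp_zero, add_zero, double_d _ _ one_ne_zero]
  rw [show ComplexShape.ε₁ (ComplexShape.down ℕ) (ComplexShape.down ℕ) (ComplexShape.down ℕ)
    (1, 0) = 1 from rfl, one_smul]
  change (dblIso₁ f).inv ▷ C.X 0 ≫ (((dblIso₁ f).hom ≫ f ≫ (dblIso₀ f).inv) ▷ C.X 0) ≫
    ιTensorObj (dbl f) C 0 0 0 _ = _
  rw [← comp_whiskerRight_assoc, Iso.inv_hom_id_assoc, comp_whiskerRight_assoc]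

/-- The minus sign is the Koszul sign for passing the differential across a factor of degree one;
`coneD` carries the same sign on its second component. -/
theorem dblIncl₁_d_succ (n : ℕ) :
    dblIncl₁ f C (n + 1) ≫ (dblTensor f C).d (n + 2) (n + 1) =
      (f ▷ C.X (n + 1)) ≫ dblIncl₀ f C (n + 1) - (A ◁ C.d (n + 1) n) ≫ dblIncl₁ f C n := by
  simp only [dblIncl₀, dblIncl₁, Category.assoc, mapBifunctor.d_eq, Preadditive.comp_add,
    mapBifunctor.ι_D₁, mapBifunctor.ι_D₂]
  rw [mapBifunctor.d₂_eq _ _ _ _ _ (show (ComplexShape.down ℕ).Rel (n + 1) n from rfl) _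
      (add_comm 1 n),
    mapBifunctor.d₁_eq _ _ _ _ (show (ComplexShape.down ℕ).Rel 1 0 from rfl) _ _
      (zero_add (n + 1)), double_d _ _ one_ne_zero]
  rw [show ComplexShape.ε₁ (ComplexShape.down ℕ) (ComplexShape.down ℕ) (ComplexShape.down ℕ)
    (1, n + 1) = 1 from rfl, one_smul,
    show ComplexShape.ε₂ (ComplexShape.down ℕ) (ComplexShape.down ℕ) (ComplexShape.down ℕ)
    (1, n + 1) = -1 from rfl, Units.neg_smul, one_smul]
  change (dblIso₁ f).inv ▷ C.X (n + 1) ≫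
    (((dblIso₁ f).hom ≫ f ≫ (dblIso₀ f).inv) ▷ C.X (n + 1)) ≫
      ιTensorObj (dbl f) C 0 (n + 1) (n + 1) _ +
    (dblIso₁ f).inv ▷ C.X (n + 1) ≫ (-(((dbl f).X 1 ◁ C.d (n + 1) n) ≫
      ιTensorObj (dbl f) C 1 n (n + 1) _)) = _
  rw [← comp_whiskerRight_assoc, Iso.inv_hom_id_assoc, comp_whiskerRight_assoc,
    Preadditive.comp_neg, whisker_exchange_assoc, sub_eq_add_neg]

end

section

variable (A : ModuleCat.{0} R) (r : R) (C : ChainComplex (ModuleCat.{0} R) ℕ)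

/-- Multiplication by `r` as a morphism. -/
abbrev mulBy : A ⟶ A := ModuleCat.ofHom (LinearMap.lsmul R A r)

theorem mulBy_whiskerRight (M : ModuleCat.{0} R) (x : (A ⊗ M : ModuleCat.{0} R)) :
    (mulBy A r ▷ M) x = r • x := by
  have : mulBy A r ▷ M = r • 𝟙 (A ⊗ M) := by
    rw [show mulBy A r = r • 𝟙 A from rfl, MonoidalLinear.smul_whiskerRight, id_whiskerRight]
  rw [this]
  rfl

/-- The map from the first summand to the cone. -/
def coneInl (r : R) (D : ChainComplex (ModuleCat.{0} R) ℕ) :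
    ∀ n, D.X n →ₗ[R] (cone r D).X n
  | 0 => LinearMap.id
  | n + 1 => LinearMap.inl R (D.X (n + 1)) (D.X n)

/-- The map from the second summand to the cone. -/
def coneInr (r : R) (D : ChainComplex (ModuleCat.{0} R) ℕ) (n : ℕ) :
    D.X n →ₗ[R] (cone r D).X (n + 1) :=
  LinearMap.inr R (D.X (n + 1)) (D.X n)

/-- The components of the map from the cone to the tensor product with a two-step complex. -/
def coneToDbl : ∀ n, (cone r (tens A C)).X n →ₗ[R] (dblTensor (mulBy A r) C).X n
  | 0 => (dblIncl₀ (mulBy A r) C 0).hom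
  | n + 1 => (dblIncl₀ (mulBy A r) C (n + 1)).hom.coprod (dblIncl₁ (mulBy A r) C n).hom

theorem coneToDbl_inl (n : ℕ) :
    ModuleCat.ofHom (coneInl r (tens A C) n) ≫ ModuleCat.ofHom (coneToDbl A r C n) =
      dblIncl₀ (mulBy A r) C n := by
  cases n with
  | zero => rfl
  | succ n =>
    exact congrArg ModuleCat.ofHom (LinearMap.coprod_inl (dblIncl₀ (mulBy A r) C (n + 1)).hom
      (dblIncl₁ (mulBy A r) C n).hom)

theorem coneToDbl_inr (n : ℕ) :
    ModuleCat.ofHom (coneInr r (tens A C) n) ≫ ModuleCat.ofHom (coneToDbl A r C (n + 1)) =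
      dblIncl₁ (mulBy A r) C n :=
  congrArg ModuleCat.ofHom (LinearMap.coprod_inr (dblIncl₀ (mulBy A r) C (n + 1)).hom
    (dblIncl₁ (mulBy A r) C n).hom)

/-- The components of the map from the tensor product with a two-step complex to the cone, on
a summand. -/
def dblToConeAux (n : ℕ) : ∀ p q : ℕ, p + q = n →
    ((dbl (mulBy A r)).X p ⊗ C.X q ⟶ (cone r (tens A C)).X n)
  | 0, q, h => ((dblIso₀ (mulBy A r)).hom ▷ C.X q) ≫ ModuleCat.ofHom (coneInl r (tens A C) q) ≫
      eqToHom (by rw [← h, zero_add])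
  | 1, q, h => ((dblIso₁ (mulBy A r)).hom ▷ C.X q) ≫ ModuleCat.ofHom (coneInr r (tens A C) q) ≫
      eqToHom (by rw [← h, add_comm])
  | _ + 2, _, _ => 0

/-- The components of the map from the tensor product with a two-step complex to the cone. -/
def dblToCone (n : ℕ) : (dblTensor (mulBy A r) C).X n ⟶ (cone r (tens A C)).X n :=
  mapBifunctorDesc fun p q h => dblToConeAux A r C n p q h

theorem dblIncl₀_dblToCone (n : ℕ) :
    dblIncl₀ (mulBy A r) C n ≫ dblToCone A r C n = ModuleCat.ofHom (coneInl r (tens A C) n) := by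
  rw [dblIncl₀, dblToCone, Category.assoc, ι_mapBifunctorDesc, dblToConeAux,
    ← comp_whiskerRight_assoc, Iso.inv_hom_id, id_whiskerRight, Category.id_comp, eqToHom_refl,
    Category.comp_id]
  rfl

theorem dblIncl₁_dblToCone (n : ℕ) :
    dblIncl₁ (mulBy A r) C n ≫ dblToCone A r C (n + 1) =
      ModuleCat.ofHom (coneInr r (tens A C) n) := by
  rw [dblIncl₁, dblToCone, Category.assoc, ι_mapBifunctorDesc, dblToConeAux,
    ← comp_whiskerRight_assoc, Iso.inv_hom_id, id_whiskerRight, Category.id_comp, eqToHom_refl,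
    Category.comp_id]
  rfl

theorem dblToCone_coneToDbl (n : ℕ) :
    dblToCone A r C n ≫ ModuleCat.ofHom (coneToDbl A r C n) = 𝟙 _ := by
  refine mapBifunctor.hom_ext fun p q h => ?_
  have h' : p + q = n := h
  refine Eq.trans ?_ (Category.comp_id _).symm
  refine (Category.assoc _ _ _).symm.trans ?_
  rw [dblToCone, ι_mapBifunctorDesc]
  match p, h' with
  | 0, h' =>
    obtain rfl : q = n := by omega
    rw [dblToConeAux, eqToHom_refl, Category.comp_id]
    refine (Category.assoc _ _ _).trans ((congrArg ((dblIso₀ (mulBy A r)).hom ▷ C.X q ≫ ·)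
      (coneToDbl_inl A r C q)).trans ?_)
    simp only [dblIncl₀]
    rw [← comp_whiskerRight_assoc, Iso.hom_inv_id, id_whiskerRight, Category.id_comp]
  | 1, h' =>
    obtain rfl : q + 1 = n := by omega
    rw [dblToConeAux, eqToHom_refl, Category.comp_id]
    refine (Category.assoc _ _ _).trans ((congrArg ((dblIso₁ (mulBy A r)).hom ▷ C.X q ≫ ·)
      (coneToDbl_inr A r C q)).trans ?_)
    simp only [dblIncl₁]
    rw [← comp_whiskerRight_assoc, Iso.hom_inv_id, id_whiskerRight, Category.id_comp]
  | p + 2, h' =>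
    -- The two-step complex vanishes in degrees two and higher.
    refine Limits.IsZero.eq_of_src ?_ _ _
    exact Functor.map_isZero (tensorRight (C.X q)) (isZero_double_X _ _ _ (by simp) (by simp))

theorem coneToDbl_dblToCone (n : ℕ) :
    ModuleCat.ofHom (coneToDbl A r C n) ≫ dblToCone A r C n = 𝟙 _ := by
  cases n with
  | zero => exact dblIncl₀_dblToCone A r C 0
  | succ n =>
    ext ⟨a, b⟩
    refine (map_add (dblToCone A r C (n + 1)).hom _ _).trans ?_
    refine (congrArg₂ (· + ·) (congr($(dblIncl₀_dblToCone A r C (n + 1)) a))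
      (congr($(dblIncl₁_dblToCone A r C n) b))).trans ?_
    exact Prod.ext (add_zero a) (zero_add b)

/-- The tensor product of the two-step complex of multiplication by `r` on `A` with a complex is
a Koszul cone. -/
theorem nonempty_dblTensor_iso : Nonempty (dblTensor (mulBy A r) C ≅ cone r (tens A C)) := by
  refine ⟨(mkIso (fun n => Iso.toLinearEquiv
    ⟨ModuleCat.ofHom (coneToDbl A r C n), dblToCone A r C n, coneToDbl_dblToCone A r C n,
      dblToCone_coneToDbl A r C n⟩) ?_).symm⟩
  rintro (_ | n) ⟨a, b⟩
  · change coneToDbl A r C 0 _ = dl (dblTensor (mulBy A r) C) 0 (coneToDbl A r C 1 _)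
    erw [dl_cone_zero]
    refine (map_add (dblIncl₀ (mulBy A r) C 0).hom _ _).trans ?_
    refine Eq.trans ?_ (map_add (dl (dblTensor (mulBy A r) C) 0) _ _).symm
    refine congrArg₂ (· + ·) (congr($(dblIncl₀_d (mulBy A r) C 0) a)).symm ?_
    refine Eq.trans ?_ (congr($(dblIncl₁_d_zero (mulBy A r) C) b)).symm
    exact congrArg (dblIncl₀ (mulBy A r) C 0) (mulBy_whiskerRight A r _ b).symm
  · change coneToDbl A r C (n + 1) _ =
      dl (dblTensor (mulBy A r) C) (n + 1) (coneToDbl A r C (n + 2) _)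
    erw [dl_cone_succ]
    refine Eq.trans ?_ (map_add (dl (dblTensor (mulBy A r) C) (n + 1)) _ _).symm
    have h1 := (congr($(dblIncl₀_d (mulBy A r) C (n + 1)) a))
    have h2 := (congr($(dblIncl₁_d_succ (mulBy A r) C n) b))
    refine Eq.trans ?_ (congrArg₂ (· + ·) h1 h2).symm
    have h3 := congrArg (dblIncl₀ (mulBy A r) C (n + 1)) (mulBy_whiskerRight A r _ b).symm
    change (dblIncl₀ (mulBy A r) C (n + 1)).hom (_ + _) +
      (dblIncl₁ (mulBy A r) C n).hom (-_) = _ + (_ - _)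
    refine (congrArg₂ (· + ·) (map_add (dblIncl₀ (mulBy A r) C (n + 1)).hom _ _)
      (map_neg (dblIncl₁ (mulBy A r) C n).hom _)).trans ?_
    exact (add_assoc _ _ _).trans (congrArg₂ (· + ·) rfl
      ((sub_eq_add_neg _ _).symm.trans (congrArg₂ (· - ·) h3 rfl)))

end

end KoszulCone

/-! ### Iterated tensor products of two-step complexes over a quotient ring. -/

namespace KoszulCone

variable {R : Type} [CommRing R]

/-- The square of a quotient ring over the base ring is the quotient ring. -/
def quotTensorSelf (I : Ideal R) : ((R ⧸ I) ⊗[R] (R ⧸ I)) ≃ₗ[R] (R ⧸ I) :=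
  (TensorProduct.quotTensorEquivQuotSMul (R ⧸ I) I).trans (Submodule.quotEquivOfEqBot _ (by
    rw [eq_bot_iff, Submodule.smul_le]
    intro r hr x _
    obtain ⟨x, rfl⟩ := Ideal.Quotient.mk_surjective x
    exact (Submodule.mem_bot R).2 (Ideal.Quotient.eq_zero_iff_mem.2 (I.mul_mem_right x hr))))

/-- Tensoring twice with a quotient ring is the same as tensoring once. -/
def tensTens (I : Ideal R) (C : ChainComplex (ModuleCat.{0} R) ℕ) :
    tens (ModuleCat.of R (R ⧸ I)) (tens (ModuleCat.of R (R ⧸ I)) C) ≅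
      tens (ModuleCat.of R (R ⧸ I)) C :=
  mkIso (fun n => (TensorProduct.assoc R (R ⧸ I) (R ⧸ I) (C.X n)).symm.trans
    (TensorProduct.congr (quotTensorSelf I) (.refl R _))) fun n y => by
    refine LinearMap.congr_fun (f := (TensorProduct.congr (quotTensorSelf I)
      (.refl R (C.X n))).toLinearMap ∘ₗ
      (TensorProduct.assoc R (R ⧸ I) (R ⧸ I) (C.X n)).symm.toLinearMap ∘ₗ
      ((dl C n).lTensor (R ⧸ I)).lTensor (R ⧸ I))
      (g := (dl C n).lTensor (R ⧸ I) ∘ₗ (TensorProduct.congr (quotTensorSelf I)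
      (.refl R (C.X (n + 1)))).toLinearMap ∘ₗ
      (TensorProduct.assoc R (R ⧸ I) (R ⧸ I) (C.X (n + 1))).symm.toLinearMap) ?_ y
    ext u v w
    simp

/-- The iterated tensor product of the two-step complexes of multiplication by the entries of a
list. -/
def tensorDbl (A : ModuleCat.{0} R) (l : List R) : ChainComplex (ModuleCat.{0} R) ℕ :=
  l.foldr (fun r T => dbl (mulBy A r) ⊗ T) (𝟙_ _)

/-- Each factor contributes its own copy of `R ⧸ I`, which idempotence of the quotient ring absorbs.
The list is reversed because the head of the tensor product becomes the outermost cone, whereas the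
head is innermost in `kos`. -/
theorem QE.tens_tensorDbl (I : Ideal R) (l : List R) :
    QE (tens (ModuleCat.of R (R ⧸ I)) (tensorDbl (ModuleCat.of R (R ⧸ I)) l))
      (KoszulCone.kos l.reverse (sgl (ModuleCat.of R (R ⧸ I)))) := by
  induction l with
  | nil =>
    exact .tens_sgl (ModuleCat.of R (R ⧸ I)) (𝟙_ (ModuleCat.{0} R)) (ModuleCat.of R (R ⧸ I))
      (TensorProduct.rid R (R ⧸ I))
  | cons r l ih =>
    rw [List.reverse_cons, kos_append]
    let A := ModuleCat.of R (R ⧸ I)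
    let e := (nonempty_dblTensor_iso A r (tensorDbl A l)).some
    have h1 : QE (tens A (tensorDbl A (r :: l)))
        (tens A (KoszulCone.cone r (tens A (tensorDbl A l)))) :=
      .of_iso (Functor.mapIso _ e)
    exact h1.trans ((QE.of_iso (tensCone A r _)).trans
      (((QE.of_iso (tensTens I _)).trans ih).cone r))

/-- The iterated tensor product of two-step complexes over a quotient ring is a Koszul complex. -/
theorem QE.tensorDbl (I : Ideal R) (l : List R) (h : l = [] → I = ⊥) :
    QE (KoszulCone.tensorDbl (ModuleCat.of R (R ⧸ I)) l) (KoszulCone.kos l (sgl (ModuleCat.of R (R ⧸ I)))) := by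
  cases l with
  | nil =>
    -- The empty tensor product is the unit `R`, which is why `I = ⊥` is required here.
    exact .of_iso ((ChainComplex.single₀ (ModuleCat.{0} R)).mapIso
      (Submodule.quotEquivOfEqBot I (h rfl)).symm.toModuleIso)
  | cons r l =>
    let A := ModuleCat.of R (R ⧸ I)
    have h1 : QE (KoszulCone.tensorDbl A (r :: l))
        (KoszulCone.cone r (tens A (KoszulCone.tensorDbl A l))) :=
      .of_iso (nonempty_dblTensor_iso A r (KoszulCone.tensorDbl A l)).some
    have h2 := h1.trans ((QE.tens_tensorDbl I l).cone r)
    have h3 : KoszulCone.cone r (KoszulCone.kos l.reverse (sgl A)) = KoszulCone.kos (r :: l).reverse (sgl A) := by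
      rw [List.reverse_cons, kos_append]
      rfl
    rw [h3] at h2
    exact h2.trans (.kos_perm (List.reverse_perm _) _)

end KoszulCone

/-! ### Combinatorics of edges, vertices and components of a resolution. -/

namespace BraidKR

namespace DecoratedBraid

variable {K : DecoratedBraid}

/-! The edges entering the crossings. -/

theorem lastEdge_eq_some {h : ℕ} {i : Fin (K.k + 1)} {u : Fin K.n} {r : Side}
    (he : K.lastEdge h i = some (u, r)) :
    K.column u r = i ∧ (u : ℕ) < h ∧
      ∀ (t : Fin K.n) (s : Side), u < t → (t : ℕ) < h → K.column t s ≠ i := by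
  induction h with
  | zero => simp [lastEdge] at he
  | succ h ih =>
    by_cases hx : ∃ (t : Fin K.n) (s : Side), (t : ℕ) = h ∧ K.column t s = i
    · obtain ⟨t, s, rfl, rfl⟩ := hx
      rw [lastEdge_succ_self] at he
      cases he
      refine ⟨rfl, Nat.lt_succ_self _, fun t' s' h1 h2 => ?_⟩
      have : (u : ℕ) < t' := h1
      omega
    · push Not at hx
      rw [lastEdge_succ_of_ne h i hx] at he
      obtain ⟨h1, h2, h3⟩ := ih he
      refine ⟨h1, by omega, fun t s h4 h5 => ?_⟩
      by_cases h6 : (t : ℕ) = h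
      · exact hx t s h6
      · exact h3 t s h4 (by omega)

theorem lastEdge_eq_none {h : ℕ} {i : Fin (K.k + 1)} (he : K.lastEdge h i = none)
    (t : Fin K.n) (s : Side) (ht : (t : ℕ) < h) : K.column t s ≠ i := by
  induction h with
  | zero => omega
  | succ h ih =>
    by_cases hx : ∃ (t : Fin K.n) (s : Side), (t : ℕ) = h ∧ K.column t s = i
    · obtain ⟨t, s, rfl, rfl⟩ := hx
      simp [lastEdge_succ_self] at he
    · push Not at hx
      rw [lastEdge_succ_of_ne h i hx] at he
      by_cases h6 : (t : ℕ) = h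
      · exact hx t s h6
      · exact ih he (by omega)

/-- The possible positions of the edge entering a crossing: it starts at the previous crossing on
the column, or there is none and the edge comes around, or it is `e_0`. -/
theorem inEdge_cases (t : Fin K.n) (s : Side) :
    (∃ u r, K.inEdge t s = some (u, r) ∧ K.column u r = K.column t s ∧ u < t ∧
      ∀ (t' : Fin K.n) (s' : Side), u < t' → t' < t → K.column t' s' ≠ K.column t s) ∨
    (∃ u r, K.inEdge t s = some (u, r) ∧ K.column u r = K.column t s ∧
      (∀ (t' : Fin K.n) (s' : Side), u < t' → K.column t' s' ≠ K.column t s) ∧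
      ∀ (t' : Fin K.n) (s' : Side), t' < t → K.column t' s' ≠ K.column t s) ∨
    (K.inEdge t s = none ∧ K.column t s = 0 ∧
      ∀ (t' : Fin K.n) (s' : Side), t' < t → K.column t' s' ≠ K.column t s) := by
  rcases h : K.lastEdge t (K.column t s) with _ | ⟨u, r⟩
  · have h1 := lastEdge_eq_none h
    by_cases h0 : K.column t s = 0
    · refine Or.inr (Or.inr ⟨?_, h0, fun t' s' h => h1 t' s' h⟩)
      rw [inEdge, h, if_pos h0]
      rfl
    · rcases h' : K.lastEdge K.n (K.column t s) with _ | ⟨u, r⟩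
      · exact absurd rfl (lastEdge_eq_none h' t s t.2)
      · obtain ⟨h2, -, h3⟩ := lastEdge_eq_some h'
        refine Or.inr (Or.inl ⟨u, r, ?_, h2, fun t' s' h => h3 t' s' h t'.2,
          fun t' s' h => h1 t' s' h⟩)
        rw [inEdge, h, if_neg h0, h']
        rfl
  · obtain ⟨h1, h2, h3⟩ := lastEdge_eq_some h
    refine Or.inl ⟨u, r, ?_, h1, h2, fun t' s' h h' => h3 t' s' h h'⟩
    rw [inEdge, h]
    rfl

/-- An edge determines its column, and only the next crossing met on that column, going around the
closure if necessary, can receive it. -/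
theorem inEdge_injective {t t' : Fin K.n} {s s' : Side} (h : K.inEdge t s = K.inEdge t' s') :
    t = t' ∧ s = s' := by
  have key : K.column t s = K.column t' s' ∧ ¬ t < t' ∧ ¬ t' < t := by
    rcases inEdge_cases t s with ⟨u, r, h1, h2, h3, h4⟩ | ⟨u, r, h1, h2, h3, h4⟩ | ⟨h1, h2, h3⟩ <;>
    rcases inEdge_cases t' s' with ⟨u', r', h1', h2', h3', h4'⟩ | ⟨u', r', h1', h2', h3', h4'⟩ |
      ⟨h1', h2', h3'⟩ <;>
    rw [h1, h1'] at h <;> try cases h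
    · have hc := h2.symm.trans h2'
      exact ⟨hc, fun hl => h4' t s h3 hl hc, fun hl => h4 t' s' h3' hl hc.symm⟩
    · have hc := h2.symm.trans h2'
      exact absurd hc (h3' t s h3)
    · have hc := h2.symm.trans h2'
      exact absurd hc.symm (h3 t' s' h3')
    · have hc := h2.symm.trans h2'
      exact ⟨hc, fun hl => h4' t s hl hc, fun hl => h4 t' s' hl hc.symm⟩
    · have hc := h2.trans h2'.symm
      exact ⟨hc, fun hl => h3' t s hl hc, fun hl => h3 t' s' hl hc.symm⟩
  have ht : t = t' := le_antisymm (not_lt.1 key.2.2) (not_lt.1 key.2.1)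
  subst ht
  exact ⟨rfl, column_inj t key.1⟩

variable {S : K.CompleteResolution}

/-! Weight functions on the edges with prescribed divergence. -/

/-- The divergence of a function on the edges at a vertex: outgoing minus incoming. -/
def Vertex.div (w : K.Edge → ℤ) : Vertex S → ℤ
  | .four t _ => w (K.outEdge t .left) + w (K.outEdge t .right)
      - w (K.inEdge t .left) - w (K.inEdge t .right)
  | .two t _ s => w (K.outEdge t s) - w (K.inEdge t s)

theorem Vertex.div_add (w w' : K.Edge → ℤ) (v : Vertex S) :
    v.div (w + w') = v.div w + v.div w' := by
  cases v <;> simp only [Vertex.div, Pi.add_apply] <;> ring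

theorem Vertex.div_sub (w w' : K.Edge → ℤ) (v : Vertex S) :
    v.div (w - w') = v.div w - v.div w' := by
  cases v <;> simp only [Vertex.div, Pi.sub_apply] <;> ring

variable (S) in
open scoped Classical in
/-- The vertex on a strand. -/
def vertexOf (t : Fin K.n) (s : Side) : Vertex S :=
  if h : t ∈ S then .four t h else .two t h s

theorem Vertex.mem_edges_iff (v : Vertex S) (e : K.Edge) :
    e ∈ v.edges ↔ ∃ t s, vertexOf S t s = v ∧ (K.outEdge t s = e ∨ K.inEdge t s = e) := by
  constructor
  · intro h
    cases v with
    | four t ht =>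
      have hv : ∀ s, vertexOf S t s = .four t ht := fun s => dif_pos ht
      simp only [Vertex.edges, Set.mem_insert_iff, Set.mem_singleton_iff] at h
      rcases h with h | h | h | h
      · exact ⟨t, .left, hv _, .inl h.symm⟩
      · exact ⟨t, .right, hv _, .inl h.symm⟩
      · exact ⟨t, .left, hv _, .inr h.symm⟩
      · exact ⟨t, .right, hv _, .inr h.symm⟩
    | two t ht s =>
      simp only [Vertex.edges, Set.mem_insert_iff, Set.mem_singleton_iff] at h
      exact ⟨t, s, dif_neg ht, h.imp Eq.symm Eq.symm⟩
  · rintro ⟨t, s, rfl, h⟩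
    unfold vertexOf
    split_ifs with ht <;> cases s <;> rcases h with rfl | rfl <;> simp [Vertex.edges]

-- The edge leaves the vertex on `(t, s)` and enters the one on `(t', s')`; if these vertices
-- coincide, the two contributions cancel.
open scoped Classical in
theorem Vertex.div_single (t t' : Fin K.n) (s s' : Side) (h : K.inEdge t' s' = K.outEdge t s)
    (v : Vertex S) : v.div (Pi.single (K.outEdge t s) 1) =
      (if vertexOf S t s = v then 1 else 0) - (if vertexOf S t' s' = v then 1 else 0) := by
  have hout : ∀ u r, (Pi.single (K.outEdge t s) (1 : ℤ) : K.Edge → ℤ) (K.outEdge u r) =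
      if t = u ∧ s = r then 1 else 0 := by
    intro u r
    rw [Pi.single_apply]
    refine if_congr ?_ rfl rfl
    simp only [outEdge, Option.some.injEq, Prod.mk.injEq]
    exact and_congr eq_comm eq_comm
  have hin : ∀ u r, (Pi.single (K.outEdge t s) (1 : ℤ) : K.Edge → ℤ) (K.inEdge u r) =
      if t' = u ∧ s' = r then 1 else 0 := by
    intro u r
    rw [Pi.single_apply]
    refine if_congr ?_ rfl rfl
    rw [← h]
    exact ⟨fun h => (inEdge_injective h.symm), by rintro ⟨rfl, rfl⟩; rfl⟩
  have hv : ∀ (t : Fin K.n) (s : Side), (if vertexOf S t s = v then (1 : ℤ) else 0) =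
      match v with
      | .four u _ => (if t = u ∧ s = .left then 1 else 0) + (if t = u ∧ s = .right then 1 else 0)
      | .two u _ r => if t = u ∧ s = r then 1 else 0 := by
    intro t s
    unfold vertexOf
    cases v with
    | four u hu =>
      by_cases htu : t = u
      · subst htu
        cases s <;> simp [hu]
      · by_cases ht : t ∈ S <;> simp [ht, htu]
    | two u hu r =>
      by_cases htu : t = u
      · subst htu
        simp [hu]
      · by_cases ht : t ∈ S <;> simp [ht, htu]
  rw [hv, hv]
  cases v with
  | four u hu => simp only [Vertex.div, hout, hin]; ring
  | two u hu r => simp only [Vertex.div, hout, hin]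

open scoped Classical in
theorem Vertex.div_single_base (t : Fin K.n) (s : Side) (h : K.inEdge t s = K.baseEdge)
    (v : Vertex S) : v.div (Pi.single K.baseEdge 1) = - (if vertexOf S t s = v then 1 else 0) := by
  have hout : ∀ u r, (Pi.single K.baseEdge (1 : ℤ) : K.Edge → ℤ) (K.outEdge u r) = 0 := by
    intro u r
    rw [Pi.single_apply]
    exact if_neg (by simp [outEdge, baseEdge])
  have hin : ∀ u r, (Pi.single K.baseEdge (1 : ℤ) : K.Edge → ℤ) (K.inEdge u r) =
      if t = u ∧ s = r then 1 else 0 := by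
    intro u r
    rw [Pi.single_apply]
    refine if_congr ?_ rfl rfl
    rw [← h]
    exact ⟨fun h => (inEdge_injective h.symm), by rintro ⟨rfl, rfl⟩; rfl⟩
  unfold vertexOf
  cases v with
  | four u hu =>
    simp only [Vertex.div, hout, hin]
    by_cases htu : t = u
    · subst htu
      cases s <;> simp [hu]
    · by_cases ht : t ∈ S <;> simp [ht, htu]
  | two u hu r =>
    simp only [Vertex.div, hout, hin]
    by_cases htu : t = u
    · subst htu
      simp [hu]
    · by_cases ht : t ∈ S <;> simp [ht, htu]

/-- A vertex is ordinary if it is not special. -/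
def Ordinary (σ : SpecialVertices S) (v : Vertex S) : Prop := ∀ C, v ≠ σ.vertex C

open scoped Classical in
/-- Some function on the edges has divergence `1` at `v` and `0` at all other ordinary vertices. -/
def HasWeight (σ : SpecialVertices S) (v : Vertex S) : Prop :=
  ∃ w : K.Edge → ℤ, ∀ v', Ordinary σ v' → v'.div w = if v = v' then 1 else 0

theorem HasWeight.of_special (σ : SpecialVertices S) (C : OtherComponent S) :
    HasWeight σ (σ.vertex C) :=
  ⟨0, fun v' hv' => by
    rw [if_neg (hv' C).symm]
    cases v' <;> simp [Vertex.div]⟩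

/-- Adding or subtracting the indicator function of the shared edge carries the unit of divergence
from one of its ends to the other. -/
theorem HasWeight.of_shared_edge (σ : SpecialVertices S) {v v' : Vertex S} (hv : HasWeight σ v)
    {e : K.Edge} (he : e ∈ v.edges) (he' : e ∈ v'.edges) : HasWeight σ v' := by
  obtain ⟨t, s, rfl, h⟩ := (v.mem_edges_iff e).1 he
  obtain ⟨t', s', rfl, h'⟩ := (v'.mem_edges_iff e).1 he'
  obtain ⟨w, hw⟩ := hv
  rcases h with rfl | rfl <;> rcases h' with h' | h'
  · cases h'
    exact ⟨w, hw⟩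
  · refine ⟨w - Pi.single (K.outEdge t s) 1, fun u hu => ?_⟩
    rw [Vertex.div_sub, hw u hu, Vertex.div_single t t' s s' h']
    ring
  · refine ⟨w + Pi.single (K.outEdge t' s') 1, fun u hu => ?_⟩
    rw [Vertex.div_add, hw u hu, Vertex.div_single t' t s' s h'.symm]
    ring
  · obtain ⟨rfl, rfl⟩ := inEdge_injective h'
    exact ⟨w, hw⟩

/-- The property spreads along shared edges, so each component needs only one starting point. A
special vertex serves with the zero function, since nothing is required there; on the remaining
component the starting point is the edge `e_0`. -/
theorem hasWeight (σ : SpecialVertices S) (v : Vertex S) : HasWeight σ v := by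
  let P : Component S → Prop := Quot.lift
    (fun e => ∀ v : Vertex S, e ∈ v.edges → HasWeight σ v) (by
      have key : ∀ e f : K.Edge, (∃ v : Vertex S, e ∈ v.edges ∧ f ∈ v.edges) →
          (∀ v : Vertex S, e ∈ v.edges → HasWeight σ v) →
          ∀ v : Vertex S, f ∈ v.edges → HasWeight σ v := by
        rintro e f ⟨v, he, hf⟩ h v' hv'
        exact (h v he).of_shared_edge σ hf hv'
      rintro e f ⟨v, he, hf⟩
      exact propext ⟨key e f ⟨v, he, hf⟩, key f e ⟨v, hf, he⟩⟩)
  have hP : ∀ C, P C := by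
    intro C
    by_cases hC : C = componentOf S K.baseEdge
    · subst hC
      intro v hv
      obtain ⟨t, s, rfl, h⟩ := (v.mem_edges_iff _).1 hv
      rcases h with h | h
      · cases h
      -- `e_0` enters a vertex but leaves none, so the negative of its indicator has divergence 1 at
      -- that vertex and 0 elsewhere.
      · refine ⟨- Pi.single K.baseEdge 1, fun u _ => ?_⟩
        rw [← zero_sub, Vertex.div_sub, Vertex.div_single_base t s h]
        cases u <;> simp [Vertex.div]
    · have h1 := σ.mem ⟨C, hC⟩
      change componentOf S _ = C at h1
      rw [← h1]
      intro v hv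
      exact (HasWeight.of_special σ ⟨C, hC⟩).of_shared_edge σ
        (by simp [SpecialVertices.vertex, Vertex.edges]) hv
  obtain ⟨e, he⟩ : ∃ e, e ∈ v.edges := by
    cases v <;> exact ⟨_, Set.mem_insert _ _⟩
  exact hP (componentOf S e) v he

/-! The sum of the linear relations over a component. -/

instance : Fintype Side := ⟨{.left, .right}, by rintro (_ | _) <;> simp⟩

-- Away from `e_0` every edge leaves a crossing. The incoming edges on `C` are thus among the
-- outgoing ones, and injectivity together with a count makes the two sets equal, so the variables
-- cancel.
open scoped Classical in
theorem sum_out_eq_sum_in (C : OtherComponent S) :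
    ∑ p ∈ Finset.univ.filter
        (fun p : Fin K.n × Side => componentOf S (K.outEdge p.1 p.2) = C.1),
      (K.U (K.outEdge p.1 p.2) - K.U (K.inEdge p.1 p.2)) = 0 := by
  set s := Finset.univ.filter
    (fun p : Fin K.n × Side => componentOf S (K.outEdge p.1 p.2) = C.1) with hs
  have hinj : Set.InjOn (fun p : Fin K.n × Side => K.inEdge p.1 p.2) s := fun p _ q _ h =>
    Prod.ext (inEdge_injective h).1 (inEdge_injective h).2
  have hinj' : Set.InjOn (fun p : Fin K.n × Side => K.outEdge p.1 p.2) s := fun p _ q _ h =>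
    Option.some.inj h
  have himg : s.image (fun p => K.inEdge p.1 p.2) = s.image (fun p => K.outEdge p.1 p.2) := by
    refine Finset.eq_of_subset_of_card_le ?_ ?_
    · intro e he
      obtain ⟨p, hp, rfl⟩ := Finset.mem_image.1 he
      have hc : componentOf S (K.inEdge p.1 p.2) = C.1 := by
        rw [componentOf_inEdge]
        simpa [hs] using hp
      rcases h : K.inEdge p.1 p.2 with _ | q
      · rw [h] at hc
        exact absurd hc.symm C.2
      · rw [h] at hc
        exact Finset.mem_image.2 ⟨q, Finset.mem_filter.2 ⟨Finset.mem_univ _, hc⟩, rfl⟩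
    · rw [Finset.card_image_of_injOn hinj, Finset.card_image_of_injOn hinj']
  rw [Finset.sum_sub_distrib, sub_eq_zero, ← Finset.sum_image (f := K.U) hinj',
    ← Finset.sum_image (f := K.U) hinj, himg]

/-- The vanishing sum over the component is solved for its special summand. A singularized crossing
has both strands on the same component and contributes `L t`; smoothed crossings contribute `Q` of
ordinary vertices. -/
theorem special_Q_mem (σ : SpecialVertices S) (C : OtherComponent S) :
    (σ.vertex C).Q ∈ idealL S ⊔ idealQ σ := by
  classical
  set J := idealL S ⊔ idealQ σ
  have h2 : ∀ (t : Fin K.n) (h : t ∉ S) (s : Side), Ordinary σ (.two t h s) →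
      K.U (K.outEdge t s) - K.U (K.inEdge t s) ∈ J := fun t h s ho =>
    Ideal.mem_sup_right (Ideal.subset_span ⟨_, ho, rfl⟩)
  have hleft : ∀ (t : Fin K.n) (h : t ∉ S), Ordinary σ (.two t h .left) := by
    intro t h C h'
    simp [SpecialVertices.vertex] at h'
  -- There is only one special vertex per component, so every other right-hand vertex on `C` is
  -- ordinary.
  have hright : ∀ (t : Fin K.n) (h : t ∉ S), t ≠ σ.crossing C →
      componentOf S (K.outEdge t .right) = C.1 → Ordinary σ (.two t h .right) := by
    intro t h ht hc C' h'
    simp only [SpecialVertices.vertex, Vertex.two.injEq, and_true] at h'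
    subst h'
    exact ht (congrArg σ.crossing (Subtype.ext ((σ.mem C').symm.trans hc)))
  let F : Fin K.n → Side → K.Ring := fun t s =>
    if componentOf S (K.outEdge t s) = C.1 then K.U (K.outEdge t s) - K.U (K.inEdge t s) else 0
  have hsum : ∑ t, (F t .left + F t .right) = 0 := by
    have := sum_out_eq_sum_in C
    rw [Finset.sum_filter, Fintype.sum_prod_type] at this
    rw [← this]
    refine Finset.sum_congr rfl fun t _ => ?_
    exact (Finset.sum_pair (by simp)).symm
  have hF : ∀ t, t ≠ σ.crossing C → F t .left + F t .right ∈ J := by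
    intro t ht
    by_cases htS : t ∈ S
    · have hlr : componentOf S (K.outEdge t .left) = componentOf S (K.outEdge t .right) :=
        Quot.sound ⟨.four t htS, by simp [Vertex.edges], by simp [Vertex.edges]⟩
      simp only [F, hlr]
      split_ifs
      · refine Ideal.mem_sup_left (Ideal.subset_span ⟨t, htS, ?_⟩)
        rw [L]
        ring
      · simp
    · refine J.add_mem ?_ ?_
      · simp only [F]
        split_ifs
        exacts [h2 t htS _ (hleft t htS), J.zero_mem]
      · simp only [F]
        split_ifs with hc
        exacts [h2 t htS _ (hright t htS ht hc), J.zero_mem]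
  rw [← Finset.add_sum_erase _ _ (Finset.mem_univ (σ.crossing C))] at hsum
  have h3 : F (σ.crossing C) .left ∈ J := by
    simp only [F]
    split_ifs
    exacts [h2 _ (σ.smoothed C) _ (hleft _ _), J.zero_mem]
  have h4 : F (σ.crossing C) .right = (σ.vertex C).Q := if_pos (σ.mem C)
  have h5 : ∑ t ∈ Finset.univ.erase (σ.crossing C), (F t .left + F t .right) ∈ J :=
    J.sum_mem fun t ht => hF t (Finset.ne_of_mem_erase ht)
  rw [← h4, show F (σ.crossing C) .right = -(F (σ.crossing C) .left) -
    ∑ t ∈ Finset.univ.erase (σ.crossing C), (F t .left + F t .right) by linear_combination hsum]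
  exact J.sub_mem (J.neg_mem h3) h5

end DecoratedBraid

end BraidKR

namespace KoszulCone

/-! Regularity criteria. -/

/-- Multiplication by `x` is injective modulo `I`. -/
def NzdMod {R : Type} [CommRing R] (I : Ideal R) (x : R) : Prop := ∀ y, x * y ∈ I → y ∈ I

/-- The set `P` collects the entries already used; regularity modulo arbitrary sets of other entries
makes the order of the list irrelevant. -/
theorem regularMod_map {R ι : Type} [CommRing R] (q : ι → R) (l : List ι) (hl : l.Nodup)
    (I : Ideal R) (P : Set ι) (hP : ∀ i ∈ l, i ∉ P)
    (h : ∀ (P : Set ι) (i : ι), i ∉ P → NzdMod (I ⊔ Ideal.span (q '' P)) (q i)) :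
    RegularMod (I ⊔ Ideal.span (q '' P)) (l.map q) := by
  induction l generalizing P with
  | nil => trivial
  | cons i l ih =>
    rw [List.nodup_cons] at hl
    refine ⟨h P i (hP i (by simp)), ?_⟩
    have := ih hl.2 (insert i P) (by
      intro j hj hjP
      rcases hjP with rfl | hjP
      · exact hl.1 hj
      · exact hP j (by simp [hj]) hjP)
    rwa [Set.image_insert_eq, Ideal.span_insert, sup_comm (Ideal.span {q i}), ← sup_assoc] at this

/-- If the `top i` form a regular sequence in every order, and each `q i` may be exchanged for
`top i` in the presence of other relations, then the `q i` form a regular sequence in every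
order. -/
theorem nzdMod_of_exchange {R ι : Type} [CommRing R] (q top : ι → R)
    (htop : ∀ (M : Set ι) (i : ι), i ∉ M → NzdMod (Ideal.span (top '' M)) (top i))
    (hex : ∀ (P M : Set ι) (i : ι), i ∉ P → i ∉ M →
      NzdMod (Ideal.span (q '' P) ⊔ Ideal.span (top '' M)) (top i) →
      NzdMod (Ideal.span (q '' P) ⊔ Ideal.span (top '' M)) (q i))
    (P : Set ι) (hP : P.Finite) (M : Set ι) (hPM : Disjoint P M) (i : ι) (hiP : i ∉ P)
    (hiM : i ∉ M) : NzdMod (Ideal.span (q '' P) ⊔ Ideal.span (top '' M)) (top i) := by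
  induction P, hP using Set.Finite.induction_on generalizing M i with
  | empty =>
    simpa using htop M i hiM
  | @insert p P hp _ ih =>
    have hpM : p ∉ M := fun h => Set.disjoint_left.1 hPM (Set.mem_insert p P) h
    have hPM' : Disjoint P M := hPM.mono_left (Set.subset_insert p P)
    have hip : i ≠ p := fun h => hiP (h ▸ Set.mem_insert p P)
    have hiP' : i ∉ P := fun h => hiP (Set.mem_insert_of_mem p h)
    have h1 := ih M hPM' i hiP' hiM
    -- With `top i` added to the relations, the induction hypothesis makes `top p` regular, and the
    -- exchange turns this into regularity of `q p`.
    have h3 := hex P (insert i M) p hp (by simp [hip.symm, hpM])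
      (ih (insert i M) (by simp [hPM', hiP']) p hp (by simp [hip.symm, hpM]))
    rw [Set.image_insert_eq, Ideal.span_insert, sup_left_comm] at h3
    rw [Set.image_insert_eq, Ideal.span_insert, sup_assoc]
    set B := Ideal.span (q '' P) ⊔ Ideal.span (top '' M)
    -- If `top i` is regular modulo `B`, and `q p` is regular modulo `B` and `top i`, then `top i`
    -- is regular modulo `B` and `q p`. This half of the permutability of regular sequences needs no
    -- local or graded hypothesis.
    intro y hy
    obtain ⟨z, b, hb, hzb⟩ := Ideal.mem_span_singleton_sup.1 hy
    have hz : z ∈ Ideal.span {top i} ⊔ B := by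
      refine h3 z ?_
      rw [show q p * z = y * top i + (-b) by linear_combination hzb]
      exact Ideal.mem_span_singleton_sup.2 ⟨y, -b, B.neg_mem hb, rfl⟩
    obtain ⟨z', b', hb', rfl⟩ := Ideal.mem_span_singleton_sup.1 hz
    have hy' : y - q p * z' ∈ B := by
      refine h1 _ ?_
      rw [show top i * (y - q p * z') = b + q p * b' by linear_combination -hzb]
      exact B.add_mem hb (B.mul_mem_left _ hb')
    exact Ideal.mem_span_singleton_sup.2 ⟨z', y - q p * z', hy', by ring⟩

section MvPolynomial

open Polynomial

variable {E : Type}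

/-- If a translation moves `x` and fixes the generators of `I`, then `x` is regular modulo `I`. -/
theorem nzdMod_of_translation (s : Set (MvPolynomial E ℤ)) (x : MvPolynomial E ℤ) (w : E → ℤ)
    (hs : ∀ y ∈ s, MvPolynomial.eval₂Hom (Int.castRingHom (MvPolynomial E ℤ)[X])
      (fun e => C (MvPolynomial.X e) + (w e : (MvPolynomial E ℤ)[X]) * X) y = C y)
    (hx : MvPolynomial.eval₂Hom (Int.castRingHom (MvPolynomial E ℤ)[X])
      (fun e => C (MvPolynomial.X e) + (w e : (MvPolynomial E ℤ)[X]) * X) x = C x + X) :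
    NzdMod (Ideal.span s) x := by
  let I := Ideal.span s
  let φ := MvPolynomial.eval₂Hom (Int.castRingHom (MvPolynomial E ℤ)[X])
      (fun e => C (MvPolynomial.X e) + (w e : (MvPolynomial E ℤ)[X]) * X)
  let ψ := (Polynomial.mapRingHom (Ideal.Quotient.mk I)).comp φ
  have hI : I ≤ RingHom.ker ψ := by
    refine Ideal.span_le.2 fun y hy => ?_
    change Polynomial.mapRingHom (Ideal.Quotient.mk I) (φ y) = 0
    rw [show φ y = C y from hs y hy, Polynomial.coe_mapRingHom, Polynomial.map_C,
      Ideal.Quotient.eq_zero_iff_mem.2 (Ideal.subset_span hy), C_0]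
  have hev : ∀ y, (ψ y).eval 0 = Ideal.Quotient.mk I y := by
    intro y
    have : (Polynomial.evalRingHom 0).comp ψ = Ideal.Quotient.mk I := by
      refine MvPolynomial.ringHom_ext (fun n => ?_) (fun e => ?_)
      · simp
      · simp [ψ, φ]
    exact RingHom.congr_fun this y
  intro y hy
  have h0 : ψ x * ψ y = 0 := by
    rw [← map_mul]
    exact hI hy
  have hψx : ψ x = X + C (Ideal.Quotient.mk I x) := by
    change Polynomial.mapRingHom (Ideal.Quotient.mk I) (φ x) = _
    rw [show φ x = C x + X from hx, Polynomial.coe_mapRingHom, Polynomial.map_add,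
      Polynomial.map_C, Polynomial.map_X, add_comm]
  -- A monic polynomial is a nonzerodivisor over any quotient ring, so `ψ y = 0`; setting `X = 0`
  -- recovers the class of `y`.
  rw [hψx, (Polynomial.monic_X_add_C _).mul_right_eq_zero_iff] at h0
  rw [← Ideal.Quotient.eq_zero_iff_mem, ← hev, h0, eval_zero]

/-- The homomorphism giving the variable `e` the weight `w e`. -/
def weigh (w : E → ℕ) : MvPolynomial E ℤ →+* (MvPolynomial E ℤ)[X] :=
  MvPolynomial.eval₂Hom (Int.castRingHom (MvPolynomial E ℤ)[X])
    (fun e => C (MvPolynomial.X e) * X ^ w e)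

theorem weigh_X (w : E → ℕ) (e : E) :
    weigh w (MvPolynomial.X e) = C (MvPolynomial.X e) * X ^ w e := by
  simp [weigh]

/-- If the generators of `I` are homogeneous, and `f` is homogeneous, regular modulo `I` and of
larger weight than `g`, then `f - g` is regular modulo `I`. -/
theorem nzdMod_of_weight (s : Set (MvPolynomial E ℤ)) (f g : MvPolynomial E ℤ) (w : E → ℕ)
    (hs : ∀ y ∈ s, ∃ k, weigh w y = C y * X ^ k) (m : ℕ)
    (hf : weigh w f = C f * X ^ (m + 1)) (hg : weigh w g = C g * X ^ m)
    (h : NzdMod (Ideal.span s) f) : NzdMod (Ideal.span s) (f - g) := by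
  let I := Ideal.span s
  let ψ := (Polynomial.mapRingHom (Ideal.Quotient.mk I)).comp (weigh w)
  have hI : I ≤ RingHom.ker ψ := by
    refine Ideal.span_le.2 fun y hy => ?_
    obtain ⟨k, hk⟩ := hs y hy
    change Polynomial.mapRingHom (Ideal.Quotient.mk I) (weigh w y) = 0
    rw [hk, Polynomial.coe_mapRingHom, Polynomial.map_mul, Polynomial.map_C,
      Ideal.Quotient.eq_zero_iff_mem.2 (Ideal.subset_span hy), C_0, zero_mul]
  have hev : ∀ y, (ψ y).eval 1 = Ideal.Quotient.mk I y := by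
    intro y
    have : (Polynomial.evalRingHom 1).comp ψ = Ideal.Quotient.mk I := by
      refine MvPolynomial.ringHom_ext (fun n => ?_) (fun e => ?_)
      · simp
      · simp [ψ, weigh_X]
    exact RingHom.congr_fun this y
  intro y hy
  have hψ : ψ (f - g) = X ^ m *
      (C (Ideal.Quotient.mk I f) * X - C (Ideal.Quotient.mk I g)) := by
    change Polynomial.mapRingHom (Ideal.Quotient.mk I) (weigh w (f - g)) = _
    rw [map_sub, hf, hg]
    simp only [Polynomial.coe_mapRingHom, Polynomial.map_sub, Polynomial.map_mul,
      Polynomial.map_C, Polynomial.map_pow, Polynomial.map_X]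
    ring
  have h0 : ψ (f - g) * ψ y = 0 := by
    rw [← map_mul]
    exact hI hy
  rw [hψ, mul_assoc, (Polynomial.monic_X_pow m).mul_right_eq_zero_iff] at h0
  -- Comparing coefficients one degree above the degree of `ψ y` shows that `f` kills its leading
  -- coefficient, which is then zero because `f` is regular modulo `I`.
  have hy0 : ψ y = 0 := by
    by_contra hne
    have h1 : ψ y * C (Ideal.Quotient.mk I f) * X = ψ y * C (Ideal.Quotient.mk I g) := by
      linear_combination h0
    have h2 := congrArg (fun p => p.coeff ((ψ y).natDegree + 1)) h1
    simp only [coeff_mul_X, coeff_mul_C] at h2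
    rw [coeff_eq_zero_of_natDegree_lt (Nat.lt_succ_self _), zero_mul] at h2
    obtain ⟨c, hc⟩ := Ideal.Quotient.mk_surjective ((ψ y).coeff (ψ y).natDegree)
    rw [← hc, ← map_mul, Ideal.Quotient.eq_zero_iff_mem, mul_comm] at h2
    refine hne (leadingCoeff_eq_zero.1 ?_)
    rw [leadingCoeff, ← hc]
    exact Ideal.Quotient.eq_zero_iff_mem.2 (h c h2)
  rw [← Ideal.Quotient.eq_zero_iff_mem, ← hev, hy0, eval_zero]

end MvPolynomial

end KoszulCone

/-! ### Regularity of the relations of the diagram, and reduction of its complex. -/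

namespace BraidKR

namespace DecoratedBraid

open KoszulCone

variable {K : DecoratedBraid} {S : K.CompleteResolution}

/-! Regularity of the linear relations. -/

/-- If every crossing is singularized, there are no special vertices and each `L u` is a divergence.
Translating the variables along weights with divergence concentrated at `t` then changes `L t`
alone. -/
theorem nzdMod_L (P : Set (Fin K.n)) (t : Fin K.n) (ht : t ∉ P) :
    NzdMod (⊥ ⊔ Ideal.span (K.L '' P)) (K.L t) := by
  obtain ⟨σ⟩ := SpecialVertices.nonempty (Finset.univ : K.CompleteResolution)
  have hord : ∀ v, Ordinary σ v := fun v C => absurd (Finset.mem_univ _) (σ.smoothed C)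
  obtain ⟨w, hw⟩ := hasWeight σ (.four t (Finset.mem_univ t))
  rw [bot_sup_eq]
  have hL : ∀ u, MvPolynomial.eval₂Hom (Int.castRingHom (Polynomial K.Ring))
      (fun e => Polynomial.C (MvPolynomial.X e) + (w e : Polynomial K.Ring) * Polynomial.X)
      (K.L u) = Polynomial.C (K.L u) + (if t = u then 1 else 0) * Polynomial.X := by
    intro u
    have h := congrArg (Int.cast : ℤ → Polynomial K.Ring) (hw (.four u (Finset.mem_univ u)) (hord _))
    simp only [Vertex.div, Vertex.four.injEq, Int.cast_add, Int.cast_sub, Int.cast_ite,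
      Int.cast_one, Int.cast_zero] at h
    simp only [L, U, map_add, map_sub, MvPolynomial.coe_eval₂Hom, MvPolynomial.eval₂_X]
    linear_combination Polynomial.X * h
  refine nzdMod_of_translation _ _ w ?_ ?_
  · rintro _ ⟨u, hu, rfl⟩
    rw [hL, if_neg (by rintro rfl; exact ht hu), zero_mul, add_zero]
  · rw [hL, if_pos rfl, one_mul]

/-! Regularity of the relations at the ordinary vertices. -/

/-- The product of the variables of the outgoing edges. -/
def Vertex.top : Vertex S → K.Ring
  | .four t _ => K.U (K.outEdge t .left) * K.U (K.outEdge t .right)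
  | .two t _ s => K.U (K.outEdge t s)

/-- The product of the variables of the incoming edges. -/
def Vertex.bot : Vertex S → K.Ring
  | .four t _ => K.U (K.inEdge t .left) * K.U (K.inEdge t .right)
  | .two t _ s => K.U (K.inEdge t s)

theorem Vertex.Q_eq (v : Vertex S) : v.Q = v.top - v.bot := by cases v <;> rfl

/-- An edge leaves only one vertex, so translating its variable alone fixes all outgoing monomials
in `M`. -/
theorem nzdMod_U (t : Fin K.n) (s : Side) (M : Set (Vertex S)) (h : vertexOf S t s ∉ M) :
    NzdMod (Ideal.span (Vertex.top '' M)) (K.U (K.outEdge t s)) := by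
  have hU : ∀ e, MvPolynomial.eval₂Hom (Int.castRingHom (Polynomial K.Ring))
      (fun e => Polynomial.C (MvPolynomial.X e) +
        ((Pi.single (K.outEdge t s) 1 : K.Edge → ℤ) e : Polynomial K.Ring) * Polynomial.X)
      (K.U e) = Polynomial.C (K.U e) + (if e = K.outEdge t s then 1 else 0) * Polynomial.X := by
    intro e
    simp [U, Pi.single_apply]
  refine nzdMod_of_translation _ _ (Pi.single (K.outEdge t s) 1) ?_ ?_
  · rintro _ ⟨v, hv, rfl⟩
    have hne : ∀ u r, vertexOf S u r = v → K.outEdge u r ≠ K.outEdge t s := by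
      rintro u r rfl h'
      cases h'
      exact h hv
    cases v with
    | four u hu =>
      have h1 := hne u .left (dif_pos hu)
      have h2 := hne u .right (dif_pos hu)
      rw [Vertex.top, map_mul, hU, hU, if_neg h1, if_neg h2, zero_mul, add_zero, add_zero,
        Polynomial.C_mul]
    | two u hu r =>
      rw [Vertex.top, hU, if_neg (hne u r (dif_neg hu)), zero_mul, add_zero]
  · rw [hU, if_pos rfl, one_mul]

theorem nzdMod_top (M : Set (Vertex S)) (v : Vertex S) (h : v ∉ M) :
    NzdMod (Ideal.span (Vertex.top '' M)) v.top := by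
  cases v with
  | four t ht =>
    intro y hy
    rw [Vertex.top, mul_assoc] at hy
    exact nzdMod_U t .right M (by rwa [vertexOf, dif_pos ht]) y
      (nzdMod_U t .left M (by rwa [vertexOf, dif_pos ht]) _ hy)
  | two t ht s => exact nzdMod_U t s M (by rwa [vertexOf, dif_neg ht])

/-- The weights of `hasWeight` are shifted to become nonnegative exponents. Every vertex has as many
outgoing as incoming edges, so the shift does not change the divergence. -/
theorem exists_weights (σ : SpecialVertices S) (v : Vertex S) (hv : Ordinary σ v) :
    ∃ w : K.Edge → ℕ, ∀ u : Vertex S, ∃ a b : ℕ,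
      weigh w u.top = Polynomial.C u.top * Polynomial.X ^ a ∧
      weigh w u.bot = Polynomial.C u.bot * Polynomial.X ^ b ∧
      (u = v → a = b + 1) ∧ (Ordinary σ u → u ≠ v → a = b) := by
  obtain ⟨w, hw⟩ := hasWeight σ v
  obtain ⟨c, hc⟩ := (Set.finite_range w).bddBelow
  have hc' : ∀ e, ((w e - c).toNat : ℤ) = w e - c := fun e =>
    Int.toNat_of_nonneg (sub_nonneg.2 (hc ⟨e, rfl⟩))
  refine ⟨fun e => (w e - c).toNat, fun u => ?_⟩
  have hdiv : Ordinary σ u → (u = v → u.div w = 1) ∧ (u ≠ v → u.div w = 0) := fun hu =>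
    ⟨fun h => by rw [hw u hu, if_pos h.symm], fun h => by rw [hw u hu, if_neg h.symm]⟩
  cases u with
  | four t ht =>
    refine ⟨(w (K.outEdge t .left) - c).toNat + (w (K.outEdge t .right) - c).toNat,
      (w (K.inEdge t .left) - c).toNat + (w (K.inEdge t .right) - c).toNat,
      ?_, ?_, fun h => ?_, fun ho h => ?_⟩
    · rw [Vertex.top, map_mul, U, U, weigh_X, weigh_X, Polynomial.C_mul, pow_add]
      ring
    · rw [Vertex.bot, map_mul, U, U, weigh_X, weigh_X, Polynomial.C_mul, pow_add]
      ring
    · have := (hdiv (h ▸ hv)).1 h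
      simp only [Vertex.div] at this
      zify
      simp only [hc']
      linarith
    · have := (hdiv ho).2 h
      simp only [Vertex.div] at this
      zify
      simp only [hc']
      linarith
  | two t ht s =>
    refine ⟨_, _, weigh_X _ _, weigh_X _ _, fun h => ?_, fun ho h => ?_⟩
    · have := (hdiv (h ▸ hv)).1 h
      simp only [Vertex.div] at this
      zify
      simp only [hc']
      linarith
    · have := (hdiv ho).2 h
      simp only [Vertex.div] at this
      zify
      simp only [hc']
      linarith

instance : Finite (Vertex S) :=
  Finite.of_surjective (fun p : Fin K.n × Side => vertexOf S p.1 p.2) (by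
    rintro (⟨t, ht⟩ | ⟨t, ht, s⟩)
    · exact ⟨(t, .left), dif_pos ht⟩
    · exact ⟨(t, s), dif_neg ht⟩)

/-- The ordinary vertices. -/
abbrev OrdinaryVertex (σ : SpecialVertices S) : Type := {v : Vertex S // Ordinary σ v}

/-- For the weights concentrated at `v`, the two monomials of every relation in `P` have equal
weight, and the elements from `M` are monomials. Hence all generators are homogeneous, while `top`
outweighs `bot` by one at `v`. -/
theorem nzdMod_Q_of_top (σ : SpecialVertices S) (P M : Set (OrdinaryVertex σ))
    (v : OrdinaryVertex σ) (hP : v ∉ P) (_ : v ∉ M)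
    (h : NzdMod (Ideal.span ((fun v : OrdinaryVertex σ => v.1.Q) '' P) ⊔
      Ideal.span ((fun v : OrdinaryVertex σ => v.1.top) '' M)) v.1.top) :
    NzdMod (Ideal.span ((fun v : OrdinaryVertex σ => v.1.Q) '' P) ⊔
      Ideal.span ((fun v : OrdinaryVertex σ => v.1.top) '' M)) v.1.Q := by
  obtain ⟨w, hw⟩ := exists_weights σ v.1 v.2
  rw [← Ideal.span_union] at h ⊢
  obtain ⟨a, b, ha, hb, hab, -⟩ := hw v.1
  rw [Vertex.Q_eq]
  refine nzdMod_of_weight _ _ _ w ?_ b (hab rfl ▸ ha) hb h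
  rintro _ (⟨u, hu, rfl⟩ | ⟨u, hu, rfl⟩)
  · obtain ⟨a, b, ha, hb, -, hab⟩ := hw u.1
    obtain rfl := hab u.2 (fun h => hP (Subtype.ext h ▸ hu))
    refine ⟨a, ?_⟩
    change weigh w u.1.Q = Polynomial.C u.1.Q * _
    rw [Vertex.Q_eq, map_sub, ha, hb, Polynomial.C_sub]
    ring
  · obtain ⟨a, -, ha, -⟩ := hw u.1
    exact ⟨a, ha⟩

theorem nzdMod_Q (σ : SpecialVertices S) (P : Set (OrdinaryVertex σ))
    (v : OrdinaryVertex σ) (hP : v ∉ P) :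
    NzdMod (⊥ ⊔ Ideal.span ((fun v : OrdinaryVertex σ => v.1.Q) '' P)) v.1.Q := by
  have h := nzdMod_Q_of_top σ P ∅ v hP (Set.notMem_empty v)
    (nzdMod_of_exchange (fun v : OrdinaryVertex σ => v.1.Q) (fun v => v.1.top) (fun M v hv => by
      have := nzdMod_top (Subtype.val '' M) v.1 (by
        rintro ⟨u, hu, h⟩
        exact hv (Subtype.ext h ▸ hu))
      rwa [Set.image_image] at this) (nzdMod_Q_of_top σ) P P.toFinite ∅ (by simp) v hP (by simp))
  simpa using h

/-! The Koszul complex of a complete resolution. -/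

theorem complexKR_eq (S : K.CompleteResolution) :
    complexKR S = tensorDbl (ModuleCat.of K.Ring K.EdgeRing)
      ((List.finRange K.n).map (stepElement S)) := by
  rw [complexKR, tensorDbl, List.ofFn_eq_map, List.foldr_map, List.foldr_map]
  rfl

open scoped Classical in
/-- The vertices at a crossing. -/
def verticesAt (S : K.CompleteResolution) (t : Fin K.n) : List (Vertex S) :=
  if h : t ∈ S then [.four t h] else [.two t h .left, .two t h .right]

open scoped Classical in
/-- The elements acting at a crossing, the linear relation included if it is not among the
generators of `L_S`. -/
def relationsAt (S : K.CompleteResolution) (t : Fin K.n) : List K.Ring :=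
  if t ∈ S then [stepElement S t] else [K.L t, stepElement S t]

/-- At a singularized crossing, the negated step element and `Q` differ by a multiple of `L t`,
which is null-homotopic on `C`. At a smoothed one, `L t` differs from `Q` of the right vertex by `Q`
of the left one, null-homotopic on the cone of the latter; hence the swap. -/
theorem QE.relationsAt (t : Fin K.n) (C : ChainComplex (ModuleCat.{0} K.Ring) ℕ)
    (hC : idealL S ≤ nullIdeal C) :
    QE (kos (relationsAt S t) C) (kos ((verticesAt S t).map Vertex.Q) C) := by
  by_cases h : t ∈ S
  · rw [DecoratedBraid.relationsAt, if_pos h, verticesAt, dif_pos h]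
    refine (QE.cone_neg _ C).trans (.cone_congr (hC ?_))
    rw [stepElement, if_pos h]
    have : K.L t ∈ idealL S := Ideal.subset_span ⟨t, h, rfl⟩
    convert (idealL S).mul_mem_left (-K.U (K.outEdge t .left)) this using 1
    simp only [Vertex.Q, L]
    ring
  · rw [DecoratedBraid.relationsAt, if_neg h, verticesAt, dif_neg h]
    have hm : stepElement S t = (Vertex.two t h .left : Vertex S).Q := by
      rw [stepElement, if_neg h]
      rfl
    rw [hm]
    refine (QE.kos_perm (List.Perm.swap _ _ _) C).trans ((QE.cone_congr ?_).trans (.refl _))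
    convert self_mem_nullIdeal_cone ((Vertex.two t h .left : Vertex S).Q) C using 1
    simp only [Vertex.Q, L]
    ring

theorem QE.flatMap_relationsAt (T : List (Fin K.n)) (C : ChainComplex (ModuleCat.{0} K.Ring) ℕ)
    (hC : idealL S ≤ nullIdeal C) :
    QE (kos (T.flatMap (DecoratedBraid.relationsAt S)) C)
      (kos ((T.flatMap (verticesAt S)).map Vertex.Q) C) := by
  induction T generalizing C with
  | nil => exact .refl _
  | cons t T ih =>
    rw [List.flatMap_cons, List.flatMap_cons, List.map_append, kos_append, kos_append]
    exact ((QE.relationsAt t C hC).kos _).trans (ih _ (hC.trans (nullIdeal_le_kos _ _)))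

open scoped Classical in
theorem flatMap_relationsAt_perm (T : List (Fin K.n)) :
    ((T.filter (· ∉ S)).map K.L ++ T.map (stepElement S)).Perm (T.flatMap (relationsAt S)) := by
  induction T with
  | nil => exact .refl _
  | cons t T ih =>
    rw [List.flatMap_cons, List.map_cons]
    refine (List.perm_middle).trans ?_
    by_cases h : t ∈ S
    · rw [List.filter_cons_of_neg (by simpa using h), relationsAt, if_pos h]
      exact ih.cons _
    · rw [List.filter_cons_of_pos (by simpa using h), relationsAt, if_neg h]
      exact (List.Perm.swap _ _ _).trans ((ih.cons _).cons _)

theorem mem_verticesAt (t : Fin K.n) (v : Vertex S) :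
    v ∈ verticesAt S t ↔ ∃ s, vertexOf S t s = v := by
  unfold verticesAt vertexOf
  by_cases h : t ∈ S
  · simp only [h, dite_true, List.mem_singleton]
    exact ⟨fun h => ⟨.left, h.symm⟩, fun ⟨_, h⟩ => h.symm⟩
  · simp only [h, dite_false, List.mem_cons, List.not_mem_nil, or_false]
    constructor
    · rintro (rfl | rfl)
      exacts [⟨_, rfl⟩, ⟨_, rfl⟩]
    · rintro ⟨_ | _, rfl⟩ <;> simp

theorem vertexOf_fst {t t' : Fin K.n} {s s' : Side} (h : vertexOf S t s = vertexOf S t' s') :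
    t = t' := by
  unfold vertexOf at h
  split_ifs at h <;> cases h <;> rfl

theorem nodup_vertices (S : K.CompleteResolution) :
    ((List.finRange K.n).flatMap (verticesAt S)).Nodup := by
  rw [List.nodup_flatMap]
  constructor
  · intro t _
    unfold verticesAt
    split_ifs <;> simp
  · refine (List.nodup_finRange K.n).imp fun {t t'} hne => ?_
    intro v hv hv'
    obtain ⟨s, rfl⟩ := (mem_verticesAt _ _).1 hv
    obtain ⟨s', h⟩ := (mem_verticesAt _ _).1 hv'
    exact hne (vertexOf_fst h).symm

theorem mem_vertices (v : Vertex S) : v ∈ (List.finRange K.n).flatMap (verticesAt S) := by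
  rw [List.mem_flatMap]
  cases v with
  | four t h => exact ⟨t, List.mem_finRange t, (mem_verticesAt _ _).2 ⟨.left, dif_pos h⟩⟩
  | two t h s => exact ⟨t, List.mem_finRange t, (mem_verticesAt _ _).2 ⟨s, dif_neg h⟩⟩

theorem vertex_injective (σ : SpecialVertices S) : Function.Injective σ.vertex := by
  intro C C' h
  simp only [SpecialVertices.vertex, Vertex.two.injEq, and_true] at h
  exact Subtype.ext ((σ.mem C).symm.trans ((congrArg (fun t => componentOf S (K.outEdge t .right))
    h).trans (σ.mem C')))

theorem finite_otherComponent (σ : SpecialVertices S) : Finite (OtherComponent S) :=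
  Finite.of_injective _ (vertex_injective σ)

/-- The ordinary vertices as a list. -/
def ordinaryList (σ : SpecialVertices S) : List (OrdinaryVertex σ) :=
  have := Fintype.ofFinite (OrdinaryVertex σ)
  Finset.univ.toList

theorem mem_ordinaryList (σ : SpecialVertices S) (v : OrdinaryVertex σ) : v ∈ ordinaryList σ := by
  simp [ordinaryList]

theorem nodup_ordinaryList (σ : SpecialVertices S) : (ordinaryList σ).Nodup :=
  Finset.nodup_toList _

/-- The relations at the ordinary vertices. -/
abbrev ordinaryRelations (σ : SpecialVertices S) : List K.Ring :=
  (ordinaryList σ).map fun v => v.1.Q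

theorem idealQ_eq (σ : SpecialVertices S) :
    idealQ σ = Ideal.span {x | x ∈ ordinaryRelations σ} := by
  rw [idealQ]
  congr 1
  ext x
  simp only [List.mem_map, Set.mem_ofPred_eq]
  exact ⟨fun ⟨v, hv, h⟩ => ⟨⟨v, hv⟩, mem_ordinaryList σ _, h⟩, fun ⟨v, _, h⟩ => ⟨v.1, v.2, h⟩⟩

theorem regularMod_ordinaryRelations (σ : SpecialVertices S) :
    RegularMod ⊥ (ordinaryRelations σ) := by
  have := regularMod_map (fun v : OrdinaryVertex σ => v.1.Q) (ordinaryList σ)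
    (nodup_ordinaryList σ) ⊥ ∅ (by simp) (nzdMod_Q σ)
  simpa using this

theorem vertices_perm (σ : SpecialVertices S) (l : List (OtherComponent S)) (hl : l.Nodup)
    (hl' : ∀ C, C ∈ l) :
    ((List.finRange K.n).flatMap (verticesAt S)).Perm
      ((ordinaryList σ).map Subtype.val ++ l.map σ.vertex) := by
  refine (List.perm_ext_iff_of_nodup (nodup_vertices S) ?_).2 fun v => ?_
  · refine List.Nodup.append ((nodup_ordinaryList σ).map Subtype.val_injective)
      (hl.map (vertex_injective σ)) fun v hv hv' => ?_
    obtain ⟨u, -, rfl⟩ := List.mem_map.1 hv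
    obtain ⟨C, -, h⟩ := List.mem_map.1 hv'
    exact u.2 C h.symm
  · refine ⟨fun _ => ?_, fun _ => mem_vertices v⟩
    rw [List.mem_append]
    by_cases hv : Ordinary σ v
    · exact Or.inl (List.mem_map.2 ⟨⟨v, hv⟩, mem_ordinaryList σ _, rfl⟩)
    · simp only [Ordinary, not_forall, not_not] at hv
      obtain ⟨C, rfl⟩ := hv
      exact Or.inr (List.mem_map.2 ⟨C, hl' C, rfl⟩)

/-- The Koszul complex of `S` is equivalent to that of the relations at the ordinary vertices,
with one zero added for each component without `e_0`, with coefficients in `R / L_S`. -/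
theorem complexKR_equiv (σ : SpecialVertices S) :
    QE (complexKR S) (kos (List.replicate (Nat.card (OtherComponent S)) 0)
      (kos (ordinaryRelations σ) (sgl (ModuleCat.of K.Ring (K.Ring ⧸ idealL S))))) := by
  classical
  have := finite_otherComponent σ
  have := Fintype.ofFinite (OtherComponent S)
  let D := sgl (ModuleCat.of K.Ring (K.Ring ⧸ idealL S))
  let T := List.finRange K.n
  have h1 : QE (complexKR S) (kos (T.map (stepElement S))
      (sgl (ModuleCat.of K.Ring (K.Ring ⧸ K.idealLK)))) := by
    rw [complexKR_eq]
    refine .tensorDbl _ _ fun h => ?_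
    -- Without crossings the linear ideal vanishes, so the empty tensor product has the right
    -- coefficients.
    have hn : K.n = 0 := by simpa using h
    have : IsEmpty (Fin K.n) := hn ▸ Fin.isEmpty'
    rw [idealLK, Set.range_eq_empty, Ideal.span_empty]
  -- The linear relations at the smoothed crossings are regular modulo `L_S`; they are brought back
  -- as Koszul entries in order to lower the coefficients from `R / L_K` to `R / L_S`.
  have h2 : QE (kos ((T.filter (· ∉ S)).map K.L) D)
      (sgl (ModuleCat.of K.Ring (K.Ring ⧸ K.idealLK))) := by
    have hS : idealL S = ⊥ ⊔ Ideal.span (K.L '' {t | t ∈ S}) := bot_sup_eq _ |>.symm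
    have hreg : RegularMod (idealL S) ((T.filter (· ∉ S)).map K.L) := by
      rw [hS]
      exact regularMod_map K.L _ ((List.nodup_finRange _).filter _) ⊥ _ (by simp) nzdMod_L
    obtain ⟨f, hf⟩ := exists_quasiIso_kos_sgl _ (idealL S) K.idealLK hreg (by
      rw [hS, bot_sup_eq, ← Ideal.span_union, idealLK]
      congr 1
      ext x
      simp only [Set.mem_range, Set.mem_union, Set.mem_image, Set.mem_ofPred_eq, List.mem_map,
        List.mem_filter, decide_eq_true_eq]
      constructor
      · rintro ⟨t, rfl⟩
        by_cases ht : t ∈ S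
        · exact Or.inl ⟨t, ht, rfl⟩
        · exact Or.inr ⟨t, ⟨List.mem_finRange t, ht⟩, rfl⟩
      · rintro (⟨t, _, rfl⟩ | ⟨t, _, rfl⟩) <;> exact ⟨t, rfl⟩)
    exact .of_quasiIso f hf
  have h3 := h1.trans (h2.symm.kos _)
  rw [← kos_append] at h3
  have hD : idealL S ≤ nullIdeal D := le_nullIdeal_sgl _
  have h4 := (h3.trans (.kos_perm (flatMap_relationsAt_perm T) D)).trans
    (QE.flatMap_relationsAt T D hD)
  have h5 := h4.trans (.kos_perm ((vertices_perm σ Finset.univ.toList (Finset.nodup_toList _)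
    (by simp)).map Vertex.Q) D)
  rw [List.map_append, kos_append, List.map_map, List.map_map] at h5
  have h6 := h5.trans (.kos_null _ _ ?_)
  · rw [List.length_map, Finset.length_toList, Finset.card_univ, ← Nat.card_eq_fintype_card] at h6
    exact h6
  · intro x hx
    obtain ⟨C, -, rfl⟩ := List.mem_map.1 hx
    -- `L_S` acts as zero on the coefficients, and the generators of `Q_S` are entries of the Koszul
    -- complex, so both ideals act null-homotopically.
    have hle : idealL S ⊔ idealQ σ ≤ nullIdeal (kos (ordinaryRelations σ) D) := by
      refine sup_le (hD.trans (nullIdeal_le_kos _ _)) ?_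
      rw [idealQ_eq]
      exact span_le_nullIdeal_kos _ _
    exact hle (special_Q_mem σ C)

end DecoratedBraid

end BraidKR

end

theorem theorem1p2 (K : BraidKR.DecoratedBraid) (S : K.CompleteResolution)
    (σ : BraidKR.DecoratedBraid.SpecialVertices S) (i : ℕ) :
    Nonempty
      ((BraidKR.DecoratedBraid.complexKR S).homology i ≃ₗ[K.Ring]
        ⨁ jl : Finset.HasAntidiagonal.antidiagonal i,
          (BraidKR.DecoratedBraid.torQuotients (BraidKR.DecoratedBraid.idealL S)
              (BraidKR.DecoratedBraid.idealQ σ) jl.1.1) ⊗[K.Ring]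
            (⋀[K.Ring]^(jl.1.2) (BraidKR.DecoratedBraid.V S))) := by
  have := BraidKR.DecoratedBraid.finite_otherComponent σ
  have := Fintype.ofFinite (BraidKR.DecoratedBraid.OtherComponent S)
  obtain ⟨e⟩ := (BraidKR.DecoratedBraid.complexKR_equiv σ).homology i
  obtain ⟨X, _, deg, ⟨f⟩, hle, hcard⟩ := KoszulCone.homology_kos_replicate_zero
    (Nat.card (BraidKR.DecoratedBraid.OtherComponent S)) (KoszulCone.kos
      (BraidKR.DecoratedBraid.ordinaryRelations σ)
      (KoszulCone.sgl (ModuleCat.of K.Ring (K.Ring ⧸ BraidKR.DecoratedBraid.idealL S)))) i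
  obtain ⟨g⟩ := KoszulCone.pi_equiv_directSum _ _
    (fun j => (KoszulCone.torQuotients_equiv (BraidKR.DecoratedBraid.idealL S) _ _
      (BraidKR.DecoratedBraid.regularMod_ordinaryRelations σ)
      (BraidKR.DecoratedBraid.idealQ_eq σ) j).some.symm) (BraidKR.DecoratedBraid.V S) i X deg hle
    (by
      intro j hj
      rw [hcard j hj, Module.finrank_finsupp_self, Nat.card_eq_fintype_card])
  exact ⟨e.trans (f.trans g)⟩
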